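/- Setting. Let $\mathsf k$ be a complex Hilbert space. For $A\subseteq\mathbb R_+=[0,\infty)$ let $\mathcal F_A$ be the Boson Fock space over $L^2(A;\mathsf k)$, with exponential vectors $\varepsilon(f)=\sum_n f^{\otimes n}/\sqrt{n!}$, and put $\mathcal F=\mathcal F_{\mathbb R_+}$, $\mathcal F_{t)}=\mathcal F_{[0,t)}$, $\mathcal F_{[t}=\mathcal F_{[t,\infty)}$; identify $\mathcal F\cong\mathcal F_{t)}\otimes\mathcal F_{[t}$ by $\varepsilon(f)\leftrightarrow\varepsilon(f|_{[0,t)})\otimes\varepsilon(f|_{[t,\infty)})$. For $t<\infty$ let $E_t=I\otimes P_t$ on $\mathcal F_{t)}\otimes\mathcal F_{[t}$, where $P_t$ is the orthogonal projection onto $\mathbb C\,\varepsilon(0|_{[t,\infty)})$, so that $E_t\varepsilon(f)=\varepsilon(1_{[0,t)}f)$; let $\Gamma_t$ be the isometry of $\mathcal F$ with $\Gamma_t\varepsilon(f)=\varepsilon(\theta_tf)$, where $(\theta_tf)(s)=1_{[t,\infty)}(s)f(s-t)$; and let $\sigma_t(X)=I_{t)}\otimes\Gamma_tX\Gamma_t^*$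 for $X\in B(\mathcal F)$, where $\Gamma_t$ is here regarded as an isometric isomorphism $\mathcal F\to\mathcal F_{[t}$ (the CCR flow). Put $E_\infty=I$, $\Gamma_\infty=E_0$, $\sigma_\infty(X)=I$. A quantum stop time is a map $S$ from the Borel sets of $[0,\infty]$ to the orthogonal projections on $\mathcal F$ such that $A\mapsto\langle x,S(A)y\rangle$ is a complex measure for all $x,y\in\mathcal F$, $S([0,\infty])=I$, $S(\{0\})\in\mathbb CI$ and $S([0,t])\in B(\mathcal F_{t)})\otimes I_{[t}$ for all $t\in(0,\infty)$. It is assumed throughout that $S(\{0\})=0$; $S$ is finite if $S(\{\infty\})=0$. For $v:[0,t]\to\mathcal F$, the integral $\int_{[0,t]}S(ds)\,v(s)$ is the limit, if it exists, of $\sum_{j=1}^{n+1}S((\pi_{j-1},\pi_j])v(\pi_j)$ over the finite partitions $\pi=\{0=\pi_0<\dots<\pi_{n+1}=t\}$ of $[0,t]$, ordered by refinement. Proposition. Let $S$ be a finite quantum stop time. (a) For every $t\in(0,\infty]$ the strong limit $E_{S,t}=\lim_\pi\sum_jS((\pi_{j-1},\pi_j])E_{\pi_j}$ over the finite partitions of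 $[0,t]$ exists and is an orthogonal projection; the strong limit $\Gamma_S=\lim_\pi\sum_jS((\pi_{j-1},\pi_j])\Gamma_{\pi_j}$ over the finite partitions of $[0,\infty]$ exists and is an isometry; and the strong limit $\sigma_S(X)=\lim_\pi\sum_j\sigma_{\pi_j}(X)S((\pi_{j-1},\pi_j])$ over the finite partitions of $[0,\infty]$ exists for every $X\in B(\mathcal F)$ (the stopped CCR flow). (b) Let $\mathcal F_{S)}$ and $\mathcal F_{[S}$ be the ranges of $E_S:=E_{S,\infty}$ and $\Gamma_S$. There is exactly one isometric isomorphism $j_S:\mathcal F_{S)}\otimes\mathcal F_{[S}\to\mathcal F$ such that \[ j_S\bigl(E_{S,t}\varepsilon(f)\otimes\Gamma_Sx\bigr)=\int_{[0,t]}S(ds)\,\varepsilon(f|_{[0,s)})\otimes\Gamma_sx\qquad\text{for all }t\in(0,\infty],\ f\in L^2(\mathbb R_+;\mathsf k),\ x\in\mathcal F, \] where $E_{S,t}\varepsilon(f)\in\mathcal F_{S)}$, in the integrand $\Gamma_sx$ is regarded as an element of $\mathcal F_{[s}$, the integral exists, and the integrand at $s=\infty$ is $\varepsilon(f)$. (c)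 With $I_{S)}$ the identity operator on $\mathcal F_{S)}$, and $\Gamma_SX\Gamma_S^*$ regarded as an operator on $\mathcal F_{[S}$, \[ \sigma_S(X)=j_S\bigl(I_{S)}\otimes\Gamma_SX\Gamma_S^*\bigr)j_S^*\qquad\text{for all }X\in B(\mathcal F). \] -/

import Mathlib

open MeasureTheory Filter Topology Set
open scoped ENNReal NNReal TensorProduct

noncomputable section

namespace StoppedCCR

/-! ### Hilbert-space tensor products -/

section HilbertTensor

variable {E F G H : Type*}
  [NormedAddCommGroup E] [InnerProductSpace ℂ E] [NormedAddCommGroup F] [InnerProductSpace ℂ F]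
  [NormedAddCommGroup G] [InnerProductSpace ℂ G] [NormedAddCommGroup H] [InnerProductSpace ℂ H]

/-- The Hilbert-space tensor product: the completion of the algebraic tensor product for the
inner product `⟪x ⊗ y, x' ⊗ y'⟫ = ⟪x, x'⟫ ⟪y, y'⟫`. -/
abbrev HTensor (E F : Type*) [NormedAddCommGroup E] [InnerProductSpace ℂ E]
    [NormedAddCommGroup F] [InnerProductSpace ℂ F] : Type _ :=
  UniformSpace.Completion (E ⊗[ℂ] F)

/-- The elementary tensor `x ⊗ y`. -/
def htmul (x : E) (y : F) : HTensor E F := ((x ⊗ₜ[ℂ] y : E ⊗[ℂ] F) : HTensor E F)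

/-- The tensor product `A ⊗ B` of bounded operators. -/
def HTensor.map (A : E →L[ℂ] G) (B : F →L[ℂ] H) : HTensor E F →L[ℂ] HTensor G H :=
  (TensorProduct.mapL A B).completion

lemma inner_htmul (x x' : E) (y y' : F) :
    inner ℂ (htmul x y) (htmul x' y') = inner ℂ x x' * inner ℂ y y' := by
  simp [htmul, UniformSpace.Completion.inner_coe]

lemma HTensor.map_htmul (A : E →L[ℂ] G) (B : F →L[ℂ] H) (x : E) (y : F) :
    HTensor.map A B (htmul x y) = htmul (A x) (B y) := by
  simp [HTensor.map, htmul]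

/-- `htmul` as a continuous bilinear map. -/
def htmulL : E →L[ℂ] F →L[ℂ] HTensor E F :=
  (ContinuousLinearMap.compL ℂ F (E ⊗[ℂ] F) (HTensor E F)
    UniformSpace.Completion.toComplL).comp (TensorProduct.mkL ℂ E F)

lemma htmulL_apply (x : E) (y : F) : htmulL x y = htmul x y := rfl

/-- A family is total if its linear span is dense. -/
def Total {ι : Type*} (φ : ι → E) : Prop := Dense (Submodule.span ℂ (range φ) : Set E)

lemma mem_of_total {ι : Type*} {φ : ι → E} (hφ : Total φ) (K : Submodule ℂ E)
    (hK : IsClosed (K : Set E)) (h : ∀ i, φ i ∈ K) (x : E) : x ∈ K := by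
  have h1 : Submodule.span ℂ (range φ) ≤ K := Submodule.span_le.2 (by rintro _ ⟨i, rfl⟩; exact h i)
  have h2 : closure (Submodule.span ℂ (range φ) : Set E) ⊆ K := closure_minimal h1 hK
  exact h2 (hφ x)

lemma total_htmul {ι κ : Type*} {φ : ι → E} {ψ : κ → F} (hφ : Total φ) (hψ : Total ψ) :
    Total (fun p : ι × κ => htmul (φ p.1) (ψ p.2)) := by
  set K : Submodule ℂ (HTensor E F) :=
    (Submodule.span ℂ (range (fun p : ι × κ => htmul (φ p.1) (ψ p.2)))).topologicalClosure with hK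
  have hKc : IsClosed (K : Set (HTensor E F)) := Submodule.isClosed_topologicalClosure _
  have h1 : ∀ i j, htmul (φ i) (ψ j) ∈ K := fun i j =>
    Submodule.le_topologicalClosure _ (Submodule.subset_span ⟨(i, j), rfl⟩)
  have h2 : ∀ x j, htmul x (ψ j) ∈ K := by
    intro x j
    refine mem_of_total hφ (K.comap ((htmulL (E := E) (F := F)).flip (ψ j)).toLinearMap) ?_
      (fun i => h1 i j) x
    exact hKc.preimage ((htmulL (E := E) (F := F)).flip (ψ j)).continuous
  have h3 : ∀ x y, htmul x y ∈ K := by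
    intro x y
    refine mem_of_total hψ (K.comap ((htmulL (E := E) (F := F)) x).toLinearMap) ?_
      (fun j => h2 x j) y
    exact hKc.preimage ((htmulL (E := E) (F := F)) x).continuous
  have h4 : ∀ z : E ⊗[ℂ] F, (z : HTensor E F) ∈ K := by
    intro z
    induction z using TensorProduct.induction_on with
    | zero => exact K.zero_mem
    | tmul x y => exact h3 x y
    | add a b ha hb => rw [UniformSpace.Completion.coe_add]; exact K.add_mem ha hb
  intro z
  have : z ∈ K := by
    refine UniformSpace.Completion.induction_on z hKc h4
  exact this

/-- A total family with the Gram matrix of another family is mapped to it by an isometry. -/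
lemma exists_isometry_of_gram {ι : Type*} [CompleteSpace G] {φ : ι → E} {ψ : ι → G}
    (hφ : Total φ) (h : ∀ i j, inner ℂ (φ i) (φ j) = inner ℂ (ψ i) (ψ j)) :
    ∃ V : E →ₗᵢ[ℂ] G, ∀ i, V (φ i) = ψ i := by
  have hin : ∀ a b : ι →₀ ℂ, inner ℂ (Finsupp.linearCombination ℂ φ a)
      (Finsupp.linearCombination ℂ φ b) = inner ℂ (Finsupp.linearCombination ℂ ψ a)
      (Finsupp.linearCombination ℂ ψ b) := by
    intro a b
    simp [Finsupp.linearCombination_apply, Finsupp.sum, h]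
  have hn : ∀ a : ι →₀ ℂ, ‖Finsupp.linearCombination ℂ ψ a‖ = ‖Finsupp.linearCombination ℂ φ a‖ := by
    intro a
    rw [@norm_eq_sqrt_re_inner ℂ, @norm_eq_sqrt_re_inner ℂ, hin]
  have hd : DenseRange (Finsupp.linearCombination ℂ φ) := by
    have : range (Finsupp.linearCombination ℂ φ) = (Submodule.span ℂ (range φ) : Set E) := by
      rw [← Finsupp.range_linearCombination]; rfl
    rw [DenseRange, this]; exact hφ
  have hb : ∃ C, ∀ a, ‖Finsupp.linearCombination ℂ ψ a‖ ≤ C * ‖Finsupp.linearCombination ℂ φ a‖ :=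
    ⟨1, fun a => by rw [one_mul, hn]⟩
  set T := (Finsupp.linearCombination ℂ ψ).extendOfNorm (Finsupp.linearCombination ℂ φ) with hT
  have hTe : ∀ a, T (Finsupp.linearCombination ℂ φ a) = Finsupp.linearCombination ℂ ψ a :=
    fun a => LinearMap.extendOfNorm_eq hd hb a
  refine ⟨⟨T.toLinearMap, fun x => ?_⟩, fun i => ?_⟩
  · refine hd.induction_on (p := fun x => ‖T x‖ = ‖x‖) x
      (isClosed_eq (T.continuous.norm) continuous_norm) (fun a => ?_)
    rw [hTe, hn]
  · have := hTe (Finsupp.single i 1)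
    simpa using this

lemma exists_isometryEquiv_of_gram {ι : Type*} [CompleteSpace E] [CompleteSpace G]
    {φ : ι → E} {ψ : ι → G} (hφ : Total φ) (hψ : Total ψ)
    (h : ∀ i j, inner ℂ (φ i) (φ j) = inner ℂ (ψ i) (ψ j)) :
    ∃ V : E ≃ₗᵢ[ℂ] G, ∀ i, V (φ i) = ψ i := by
  obtain ⟨V, hV⟩ := exists_isometry_of_gram hφ h
  have hs : Function.Surjective V := by
    intro y
    refine mem_of_total hψ (LinearMap.range V.toLinearMap) ?_ (fun i => ⟨φ i, hV i⟩) y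
    exact V.isometry.isClosedEmbedding.isClosed_range
  exact ⟨LinearIsometryEquiv.ofSurjective V hs, fun i => by simpa using hV i⟩

end HilbertTensor

/-! ### Boson Fock space -/

section FockSpace

/-- A complex Hilbert space, bundled (used only to define tensor powers by recursion). -/
structure HilbertSpaceBundle.{u} where
  carrier : Type u
  [normed : NormedAddCommGroup carrier]
  [inner : InnerProductSpace ℂ carrier]
  [complete : CompleteSpace carrier]

attribute [instance] HilbertSpaceBundle.normed HilbertSpaceBundle.inner HilbertSpaceBundle.complete

/-- `H^{⊗ 0} = ℂ` and `H^{⊗ (n + 1)} = H ⊗ H^{⊗ n}`. -/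
def tensorPowerBundle.{u} (H : Type u) [NormedAddCommGroup H] [InnerProductSpace ℂ H] :
    ℕ → HilbertSpaceBundle.{u}
  | 0 => ⟨EuclideanSpace ℂ PUnit.{u + 1}⟩
  | n + 1 => ⟨HTensor H (tensorPowerBundle H n).carrier⟩

variable (H : Type*) [NormedAddCommGroup H] [InnerProductSpace ℂ H]

/-- The Hilbert-space tensor power `H^{⊗ n}`. -/
abbrev HTensorPower (n : ℕ) : Type _ := (tensorPowerBundle H n).carrier

variable {H} in
/-- The vector `f^{⊗ n}`. -/
def tpow (f : H) : (n : ℕ) → HTensorPower H n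
  | 0 => (EuclideanSpace.single PUnit.unit (1 : ℂ) : EuclideanSpace ℂ PUnit)
  | n + 1 => htmul f (tpow f n)

variable {H} in
lemma inner_tpow (f g : H) (n : ℕ) : inner ℂ (tpow f n) (tpow g n) = (inner ℂ f g) ^ n := by
  induction n with
  | zero =>
    change inner ℂ (EuclideanSpace.single PUnit.unit (1 : ℂ) : EuclideanSpace ℂ PUnit)
      (EuclideanSpace.single PUnit.unit (1 : ℂ) : EuclideanSpace ℂ PUnit) = _
    simp
  | succ n ih =>
    change inner ℂ (htmul f (tpow f n)) (htmul g (tpow g n)) = _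
    rw [inner_htmul, ih, pow_succ, mul_comm]

variable {H} in
lemma tpow_smul (c : ℂ) (f : H) (n : ℕ) : tpow (c • f) n = c ^ n • tpow f n := by
  induction n with
  | zero => exact (by rw [pow_zero, one_smul]; rfl)
  | succ n ih =>
    change htmul (c • f) (tpow (c • f) n) = c ^ (n + 1) • htmul f (tpow f n)
    rw [ih, ← htmulL_apply, ← htmulL_apply, map_smul, map_smul, smul_apply,
      smul_smul, pow_succ]

/-- The symmetric tensor power: the closed linear span of the vectors `f^{⊗ n}`. -/
def SymPower (n : ℕ) : Submodule ℂ (HTensorPower H n) :=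
  (Submodule.span ℂ (range fun f : H => tpow f n)).topologicalClosure

instance (n : ℕ) : CompleteSpace (SymPower H n) :=
  (Submodule.isClosed_topologicalClosure _).completeSpace_coe

/-- Boson Fock space over `H`: the Hilbert-space direct sum of the symmetric tensor powers. -/
abbrev Fock : Type _ := lp (fun n : ℕ => SymPower H n) 2

variable {H}

/-- `f^{⊗ n}` as an element of the symmetric tensor power. -/
def symPow (f : H) (n : ℕ) : SymPower H n :=
  ⟨tpow f n, Submodule.le_topologicalClosure _ (Submodule.subset_span ⟨f, rfl⟩)⟩

lemma inner_symPow (f g : H) (n : ℕ) : inner ℂ (symPow f n) (symPow g n) = (inner ℂ f g) ^ n :=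
  inner_tpow f g n

lemma norm_symPow (f : H) (n : ℕ) : ‖symPow f n‖ ^ 2 = (‖f‖ ^ 2) ^ n := by
  have h := inner_symPow f f n
  rw [inner_self_eq_norm_sq_to_K, inner_self_eq_norm_sq_to_K] at h
  exact_mod_cast h

lemma memlp_exp (f : H) :
    Memℓp (fun n : ℕ => ((Real.sqrt (n.factorial : ℝ))⁻¹ : ℂ) • symPow f n) 2 := by
  refine memℓp_gen ?_
  have : Summable fun n : ℕ => (‖f‖ ^ 2) ^ n / (n.factorial : ℝ) := Real.summable_pow_div_factorial _
  refine this.congr fun n => ?_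
  have h2 : (2 : ℝ≥0∞).toReal = ((2 : ℕ) : ℝ) := by simp
  rw [h2, Real.rpow_natCast, norm_smul, mul_pow, norm_symPow, norm_inv, inv_pow,
    Complex.norm_real, Real.norm_eq_abs, sq_abs, Real.sq_sqrt (by positivity), div_eq_inv_mul]

/-- The exponential vector `ε(f) = ∑ f^{⊗ n} / √n!`. -/
def expVec (f : H) : Fock H :=
  ⟨fun n : ℕ => ((Real.sqrt (n.factorial : ℝ))⁻¹ : ℂ) • symPow f n, memlp_exp f⟩

lemma expVec_apply (f : H) (n : ℕ) :
    (expVec f : ∀ n, SymPower H n) n = ((Real.sqrt (n.factorial : ℝ))⁻¹ : ℂ) • symPow f n := rfl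

lemma inner_expVec (f g : H) : inner ℂ (expVec f) (expVec g) = Complex.exp (inner ℂ f g) := by
  have h1 := lp.hasSum_inner (𝕜 := ℂ) (expVec f) (expVec g)
  have h2 : HasSum (fun n : ℕ => (inner ℂ f g) ^ n / (n.factorial : ℂ))
      (Complex.exp (inner ℂ f g)) := by
    rw [Complex.exp_eq_exp_ℂ]
    exact NormedSpace.expSeries_div_hasSum_exp (inner ℂ f g)
  refine h1.unique (h2.congr_fun ?_ |>.congr_fun fun _ => rfl)
  intro n
  rw [expVec_apply, expVec_apply, inner_smul_left, inner_smul_right, inner_symPow]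
  have h3 : ((Real.sqrt (n.factorial : ℝ) : ℝ) : ℂ) * (Real.sqrt (n.factorial : ℝ) : ℝ)
      = (n.factorial : ℂ) := by
    rw [← Complex.ofReal_mul, Real.mul_self_sqrt (by positivity)]; simp
  rw [map_inv₀, Complex.conj_ofReal, ← mul_assoc, ← mul_inv, h3, div_eq_inv_mul]

lemma total_expVec : Total (expVec : H → Fock H) := by
  have key : (Submodule.span ℂ (range (expVec : H → Fock H)))ᗮ = ⊥ := by
    rw [Submodule.eq_bot_iff]
    intro x hx
    have hx' : ∀ f : H, inner ℂ x (expVec f) = 0 := fun f =>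
      (Submodule.mem_orthogonal' _ _).1 hx _ (Submodule.subset_span ⟨f, rfl⟩)
    have hc : ∀ (f : H) (n : ℕ), inner ℂ ((x : ∀ n, SymPower H n) n) (symPow f n) = 0 := by
      intro f
      set a : ℕ → ℂ := fun n => inner ℂ ((x : ∀ n, SymPower H n) n)
        ((expVec f : ∀ n, SymPower H n) n) with ha
      have hs : ∀ z : ℂ, HasSum (fun n => z ^ n * a n) 0 := by
        intro z
        have := lp.hasSum_inner (𝕜 := ℂ) x (expVec (z • f))
        rw [hx'] at this
        refine this.congr_fun fun n => ?_
        simp only [ha, expVec_apply]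
        have : symPow (z • f) n = z ^ n • symPow f n := Subtype.ext (tpow_smul z f n)
        rw [this, inner_smul_right, inner_smul_right, inner_smul_right]
        ring
      have hp : HasFPowerSeriesAt (fun _ : ℂ => (0 : ℂ)) (FormalMultilinearSeries.ofScalars ℂ a) 0 := by
        rw [hasFPowerSeriesAt_iff]
        refine Filter.Eventually.of_forall fun z => ?_
        simpa [FormalMultilinearSeries.coeff_ofScalars] using hs z
      have h0 := hp.eq_zero
      intro n
      have h1 : a n = 0 := by
        have := congrArg (fun p => FormalMultilinearSeries.coeff p n) h0
        rw [FormalMultilinearSeries.coeff_ofScalars] at this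
        rw [this]; rfl
      rw [ha] at h1
      simp only [expVec_apply, inner_smul_right, mul_eq_zero] at h1
      rcases h1 with h1 | h1
      · exfalso
        have : Real.sqrt (n.factorial : ℝ) ≠ 0 := by positivity
        simp_all
      · exact h1
    ext n
    have hz : ∀ y : HTensorPower H n, y ∈ SymPower H n →
        inner ℂ (((x : ∀ n, SymPower H n) n : SymPower H n) : HTensorPower H n) y = 0 := by
      intro y hy
      have hcl : IsClosed {y : HTensorPower H n |
          inner ℂ (((x : ∀ n, SymPower H n) n : SymPower H n) : HTensorPower H n) y = 0} :=
        isClosed_eq (by fun_prop) continuous_const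
      have hy' : y ∈ closure
          (Submodule.span ℂ (range fun f : H => tpow f n) : Set (HTensorPower H n)) := hy
      refine closure_minimal ?_ hcl hy'
      intro y hy
      induction hy using Submodule.span_induction with
      | mem y hy => obtain ⟨f, rfl⟩ := hy; exact hc f n
      | zero => simp
      | add a b _ _ ha hb => simp only [mem_ofPred_eq] at *; rw [inner_add_right, ha, hb, add_zero]
      | smul c a _ ha => simp only [mem_ofPred_eq] at *; rw [inner_smul_right, ha, mul_zero]
    have := hz _ ((x : ∀ n, SymPower H n) n).2
    simpa using this
  have := (Submodule.topologicalClosure_eq_top_iff).2 key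
  exact (Submodule.dense_iff_topologicalClosure_eq_top).2 this

/-- The second quantisation of an isometry exists. -/
lemma exists_secondQuantisation {K : Type*} [NormedAddCommGroup K] [InnerProductSpace ℂ K]
    (V : H →ₗᵢ[ℂ] K) : ∃ W : Fock H →ₗᵢ[ℂ] Fock K, ∀ f, W (expVec f) = expVec (V f) :=
  exists_isometry_of_gram total_expVec fun f g => by
    rw [inner_expVec, inner_expVec, V.inner_map_map]

/-- The second quantisation of an isometry `V`: the isometry with `ε(f) ↦ ε(V f)`. -/
def secondQuantisation {K : Type*} [NormedAddCommGroup K] [InnerProductSpace ℂ K]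
    (V : H →ₗᵢ[ℂ] K) : Fock H →ₗᵢ[ℂ] Fock K := (exists_secondQuantisation V).choose

lemma secondQuantisation_expVec {K : Type*} [NormedAddCommGroup K] [InnerProductSpace ℂ K]
    (V : H →ₗᵢ[ℂ] K) (f : H) : secondQuantisation V (expVec f) = expVec (V f) :=
  (exists_secondQuantisation V).choose_spec f

/-- The orthogonal projection onto `ℂ ε(0)`. -/
def vacuumProj (H : Type*) [NormedAddCommGroup H] [InnerProductSpace ℂ H] :
    Fock H →L[ℂ] Fock H :=
  (ℂ ∙ (expVec (0 : H))).starProjection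

end FockSpace

/-! ### The spaces `L²(A; k)` -/

section LTwo

variable (k : Type*) [NormedAddCommGroup k] [InnerProductSpace ℂ k]

/-- `L²(A; k)` with Lebesgue measure, for `A ⊆ ℝ`. -/
abbrev LTwo (A : Set ℝ) : Type _ := Lp k 2 (volume.restrict A)

variable {k} {A B : Set ℝ}

/-- Restriction of functions, `f ↦ f|_A`. -/
def LTwo.restrict (h : A ⊆ B) : LTwo k B →L[ℂ] LTwo k A :=
  LinearMap.mkContinuous
    { toFun := fun f => MemLp.toLp f ((Lp.memLp f).mono_measure (Measure.restrict_mono_set _ h))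
      map_add' := fun f g => by
        rw [← MemLp.toLp_add]
        exact MemLp.toLp_congr _ _ (ae_mono (Measure.restrict_mono_set _ h) (Lp.coeFn_add f g))
      map_smul' := fun c f => by
        rw [RingHom.id_apply, ← MemLp.toLp_const_smul]
        exact MemLp.toLp_congr _ _ (ae_mono (Measure.restrict_mono_set _ h) (Lp.coeFn_smul c f)) }
    1 (fun f => by
      rw [one_mul, LinearMap.coe_mk, AddHom.coe_mk, Lp.norm_toLp, Lp.norm_def]
      exact ENNReal.toReal_mono (Lp.eLpNorm_ne_top _)
        (eLpNorm_mono_measure _ (Measure.restrict_mono_set _ h)))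

lemma LTwo.coeFn_restrict (h : A ⊆ B) (f : LTwo k B) :
    LTwo.restrict h f =ᵐ[volume.restrict A] f :=
  MemLp.coeFn_toLp ((Lp.memLp f).mono_measure (Measure.restrict_mono_set _ h))

lemma memLp_indicator {k : Type*} [NormedAddCommGroup k] (hA : MeasurableSet A) (f : LTwo k A) :
    MemLp (A.indicator f) 2 (volume.restrict B) :=
  ((memLp_indicator_iff_restrict hA).2 (Lp.memLp f)).mono_measure Measure.restrict_le_self

lemma indicator_congr_restrict {k : Type*} [NormedAddCommGroup k] (hA : MeasurableSet A)
    {f g : ℝ → k}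
    (h : f =ᵐ[volume.restrict A] g) :
    A.indicator f =ᵐ[volume.restrict B] A.indicator g :=
  ae_mono Measure.restrict_le_self (by
    filter_upwards [(ae_restrict_iff' hA).1 h] with s hs
    by_cases h' : s ∈ A
    · rw [indicator_of_mem h', indicator_of_mem h', hs h']
    · rw [indicator_of_notMem h', indicator_of_notMem h'])

/-- Extension of functions by zero. -/
def LTwo.extend (hA : MeasurableSet A) (h : A ⊆ B) : LTwo k A →ₗᵢ[ℂ] LTwo k B where
  toFun f := (memLp_indicator hA f).toLp (A.indicator f)
  map_add' f g := by
    rw [← MemLp.toLp_add]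
    refine MemLp.toLp_congr _ _ ?_
    rw [← indicator_add']
    exact indicator_congr_restrict hA (Lp.coeFn_add f g)
  map_smul' c f := by
    rw [RingHom.id_apply, ← MemLp.toLp_const_smul]
    refine MemLp.toLp_congr _ _ ?_
    have hc : c • A.indicator (f : ℝ → k) = A.indicator (c • (f : ℝ → k)) :=
      (indicator_const_smul A c (f : ℝ → k)).symm
    rw [hc]
    exact indicator_congr_restrict hA (Lp.coeFn_smul c f)
  norm_map' f := by
    change ‖(memLp_indicator hA f).toLp (A.indicator f)‖ = _
    rw [Lp.norm_toLp, Lp.norm_def, eLpNorm_indicator_eq_eLpNorm_restrict hA,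
      Measure.restrict_restrict hA, inter_eq_left.2 h]

lemma LTwo.coeFn_extend (hA : MeasurableSet A) (h : A ⊆ B) (f : LTwo k A) :
    LTwo.extend hA h f =ᵐ[volume.restrict B] A.indicator f :=
  MemLp.coeFn_toLp (memLp_indicator hA f)

lemma Ico_sub (t : ℝ≥0) : Ico 0 (t : ℝ) ⊆ Ici 0 := Ico_subset_Ici_self

lemma Ici_sub (t : ℝ≥0) : Ici (t : ℝ) ⊆ Ici 0 := Ici_subset_Ici.2 t.2

lemma restrict_glue (t : ℝ≥0) (u : LTwo k (Ico 0 (t : ℝ))) (v : LTwo k (Ici (t : ℝ))) :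
    ∃ f : LTwo k (Ici 0), LTwo.restrict (Ico_sub t) f = u ∧ LTwo.restrict (Ici_sub t) f = v := by
  refine ⟨LTwo.extend measurableSet_Ico (Ico_sub t) u +
    LTwo.extend measurableSet_Ici (Ici_sub t) v, ?_, ?_⟩
  · refine Lp.ext ?_
    filter_upwards [LTwo.coeFn_restrict (Ico_sub t) (LTwo.extend measurableSet_Ico (Ico_sub t) u +
      LTwo.extend measurableSet_Ici (Ici_sub t) v),
      ae_mono (Measure.restrict_mono_set _ (Ico_sub t)) (Lp.coeFn_add
        (LTwo.extend measurableSet_Ico (Ico_sub t) u)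
        (LTwo.extend measurableSet_Ici (Ici_sub t) v)),
      ae_mono (Measure.restrict_mono_set _ (Ico_sub t))
        (LTwo.coeFn_extend measurableSet_Ico (Ico_sub t) u),
      ae_mono (Measure.restrict_mono_set _ (Ico_sub t))
        (LTwo.coeFn_extend measurableSet_Ici (Ici_sub t) v),
      ae_restrict_mem measurableSet_Ico] with s h1 h2 h3 h4 h5
    rw [h1, h2, Pi.add_apply, h3, h4, indicator_of_mem h5,
      indicator_of_notMem (by simpa using h5.2), add_zero]
  · refine Lp.ext ?_
    filter_upwards [LTwo.coeFn_restrict (Ici_sub t) (LTwo.extend measurableSet_Ico (Ico_sub t) u +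
      LTwo.extend measurableSet_Ici (Ici_sub t) v),
      ae_mono (Measure.restrict_mono_set _ (Ici_sub t)) (Lp.coeFn_add
        (LTwo.extend measurableSet_Ico (Ico_sub t) u)
        (LTwo.extend measurableSet_Ici (Ici_sub t) v)),
      ae_mono (Measure.restrict_mono_set _ (Ici_sub t))
        (LTwo.coeFn_extend measurableSet_Ico (Ico_sub t) u),
      ae_mono (Measure.restrict_mono_set _ (Ici_sub t))
        (LTwo.coeFn_extend measurableSet_Ici (Ici_sub t) v),
      ae_restrict_mem measurableSet_Ici] with s h1 h2 h3 h4 h5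
    rw [h1, h2, Pi.add_apply, h3, h4, indicator_of_mem h5,
      indicator_of_notMem (fun h => absurd h.2 (not_lt.2 h5)), zero_add]

lemma inner_restrict_add (t : ℝ≥0) (f g : LTwo k (Ici 0)) :
    inner ℂ (LTwo.restrict (Ico_sub t) f) (LTwo.restrict (Ico_sub t) g) +
      inner ℂ (LTwo.restrict (Ici_sub t) f) (LTwo.restrict (Ici_sub t) g) = inner ℂ f g := by
  rw [L2.inner_def, L2.inner_def, L2.inner_def]
  have hu : Ico 0 (t : ℝ) ∪ Ici (t : ℝ) = Ici 0 := Ico_union_Ici_eq_Ici t.2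
  have hi : Integrable (fun s => inner ℂ (f s) (g s)) (volume.restrict (Ici (0 : ℝ))) :=
    L2.integrable_inner f g
  have hr : ∫ s, inner ℂ (f s) (g s) ∂(volume.restrict (Ici (0 : ℝ))) =
      ∫ s, inner ℂ (f s) (g s) ∂(volume.restrict (Ico 0 (t : ℝ) ∪ Ici (t : ℝ))) := by
    simp only [hu]
  have hdj : Disjoint (Ico 0 (t : ℝ)) (Ici (t : ℝ)) :=
    Set.disjoint_left.2 fun s h h' => absurd h.2 (not_lt.2 h')
  rw [hr, setIntegral_union hdj measurableSet_Ici (IntegrableOn.mono_set hi (Ico_sub t)) (IntegrableOn.mono_set hi (Ici_sub t))]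
  congr 1
  · refine integral_congr_ae ?_
    filter_upwards [LTwo.coeFn_restrict (Ico_sub t) f, LTwo.coeFn_restrict (Ico_sub t) g] with s h h'
    rw [h, h']
  · refine integral_congr_ae ?_
    filter_upwards [LTwo.coeFn_restrict (Ici_sub t) f, LTwo.coeFn_restrict (Ici_sub t) g] with s h h'
    rw [h, h']

lemma measurePreserving_sub_Ici (t : ℝ) :
    MeasurePreserving (fun s : ℝ => s - t) (volume.restrict (Ici t)) (volume.restrict (Ici 0)) := by
  have h := (measurePreserving_sub_right (volume : Measure ℝ) t).restrict_preimage
    (measurableSet_Ici (a := (0 : ℝ)))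
  have h2 : (fun s : ℝ => s - t) ⁻¹' Ici 0 = Ici t := by ext s; simp
  rwa [h2] at h

/-- The right shift regarded as a map onto `L²([t, ∞); k)`: `(θ_t f)(s) = f(s - t)` for `s ≥ t`. -/
def shiftTo (t : ℝ≥0) : LTwo k (Ici 0) →ₗᵢ[ℂ] LTwo k (Ici (t : ℝ)) :=
  Lp.compMeasurePreservingₗᵢ ℂ (fun s : ℝ => s - t) (measurePreserving_sub_Ici (t : ℝ))

/-- The isometric right shift `θ_t` on `L²(ℝ₊; k)`: `(θ_t f)(s)` is `f(s - t)` for `s ≥ t` and `0`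
for `s < t`. -/
def rightShift (t : ℝ≥0) : LTwo k (Ici 0) →ₗᵢ[ℂ] LTwo k (Ici 0) :=
  (LTwo.extend measurableSet_Ici (Ici_sub t)).comp (shiftTo t)

end LTwo

/-! ### Fock space over `L²(ℝ₊; k)`, its decompositions, time projections and shifts -/

section FockTime

variable (k : Type*) [NormedAddCommGroup k] [InnerProductSpace ℂ k]

/-- `F`, the Fock space over `L²(ℝ₊; k)`. -/
abbrev FockR : Type _ := Fock (LTwo k (Ici 0))

/-- `F_{t)}`, the Fock space over `L²([0, t); k)`. -/
abbrev FockBefore (t : ℝ≥0) : Type _ := Fock (LTwo k (Ico 0 (t : ℝ)))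

/-- `F_{[t}`, the Fock space over `L²([t, ∞); k)`. -/
abbrev FockAfter (t : ℝ≥0) : Type _ := Fock (LTwo k (Ici (t : ℝ)))

variable {k}

lemma exists_split (t : ℝ≥0) :
    ∃ U : FockR k ≃ₗᵢ[ℂ] HTensor (FockBefore k t) (FockAfter k t), ∀ f : LTwo k (Ici 0),
      U (expVec f) = htmul (expVec (LTwo.restrict (Ico_sub t) f))
        (expVec (LTwo.restrict (Ici_sub t) f)) := by
  refine exists_isometryEquiv_of_gram total_expVec ?_ fun f g => ?_
  · have h := total_htmul (total_expVec (H := LTwo k (Ico 0 (t : ℝ))))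
      (total_expVec (H := LTwo k (Ici (t : ℝ))))
    refine h.mono (Submodule.span_mono ?_)
    rintro _ ⟨⟨u, v⟩, rfl⟩
    obtain ⟨f, rfl, rfl⟩ := restrict_glue t u v
    exact ⟨f, rfl⟩
  · rw [inner_htmul, inner_expVec, inner_expVec, inner_expVec, ← Complex.exp_add,
      inner_restrict_add]

/-- The identification `F ≅ F_{t)} ⊗ F_{[t}` with `ε(f) ↔ ε(f|_{[0,t)}) ⊗ ε(f|_{[t,∞)})`. -/
def split (t : ℝ≥0) : FockR k ≃ₗᵢ[ℂ] HTensor (FockBefore k t) (FockAfter k t) :=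
  (exists_split t).choose

lemma split_expVec (t : ℝ≥0) (f : LTwo k (Ici 0)) :
    split t (expVec f) = htmul (expVec (LTwo.restrict (Ico_sub t) f))
        (expVec (LTwo.restrict (Ici_sub t) f)) :=
  (exists_split t).choose_spec f

/-- For `A ∈ B(F_{t)})` and `B ∈ B(F_{[t})`, the operator on `F` identified with `A ⊗ B`. -/
def tensorAt (t : ℝ≥0) (A : FockBefore k t →L[ℂ] FockBefore k t)
    (B : FockAfter k t →L[ℂ] FockAfter k t) : FockR k →L[ℂ] FockR k :=
  ((split (k := k) t).symm : HTensor (FockBefore k t) (FockAfter k t) →L[ℂ] FockR k) ∘L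
    HTensor.map A B ∘L (split (k := k) t : FockR k →L[ℂ] HTensor (FockBefore k t) (FockAfter k t))

/-- The projection `E_t`, `t ∈ [0, ∞]`: for `t < ∞` it is `I_{t)} ⊗ P`, with `P` the orthogonal
projection onto `ℂ ε(0|_{[t,∞)})`, and `E_∞ = I`. -/
def timeProj (t : ℝ≥0∞) : FockR k →L[ℂ] FockR k :=
  if t = ∞ then 1 else tensorAt t.toNNReal 1 (vacuumProj (LTwo k (Ici (t.toNNReal : ℝ))))

/-- `Γ_t`, `t ∈ [0, ∞]`: the second quantisation of `θ_t` for `t < ∞`, and `Γ_∞ = E_0`. -/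
def shiftOp (t : ℝ≥0∞) : FockR k →L[ℂ] FockR k :=
  if t = ∞ then vacuumProj (LTwo k (Ici 0))
  else (secondQuantisation (rightShift t.toNNReal)).toContinuousLinearMap

/-- `Γ_t` regarded as a map from `F` onto `F_{[t}`. -/
def shiftOpTo (t : ℝ≥0) : FockR k →L[ℂ] FockAfter k t :=
  (secondQuantisation (shiftTo t)).toContinuousLinearMap

variable [CompleteSpace k]

/-- The CCR flow: `σ_t(X) = I_{t)} ⊗ Γ_t X Γ_t^*` for `t < ∞`, and `σ_∞(X) = I`. -/
def ccrFlow (t : ℝ≥0∞) (X : FockR k →L[ℂ] FockR k) : FockR k →L[ℂ] FockR k :=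
  if t = ∞ then 1
  else tensorAt t.toNNReal 1
    (shiftOpTo t.toNNReal ∘L X ∘L ContinuousLinearMap.adjoint (shiftOpTo t.toNNReal))

/-- The vector `ε(f|_{[0,s)}) ⊗ Γ_s x`, with the convention that it is `ε(f)` for `s = ∞`. -/
def expShift (f : LTwo k (Ici 0)) (x : FockR k) (s : ℝ≥0∞) : FockR k :=
  if s = ∞ then expVec f
  else (split s.toNNReal).symm
    (htmul (expVec (LTwo.restrict (Ico_sub s.toNNReal) f)) (shiftOpTo s.toNNReal x))

end FockTime

/-! ### Quantum stop times -/

section StopTime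

variable (k : Type*) [NormedAddCommGroup k] [InnerProductSpace ℂ k] [CompleteSpace k]

/-- A quantum stop time: an identity-adapted spectral measure on the Borel sets of `[0, ∞]` (only
the values at Borel sets are relevant). -/
structure QuantumStopTime where
  toFun : Set ℝ≥0∞ → FockR k →L[ℂ] FockR k
  isStarProjection : ∀ A, MeasurableSet A → IsStarProjection (toFun A)
  complexMeasure : ∀ x y : FockR k, ∃ μ : ComplexMeasure ℝ≥0∞,
    ∀ A, MeasurableSet A → μ A = inner ℂ x (toFun A y)
  map_univ : toFun univ = 1
  map_zero : ∃ c : ℂ, toFun {0} = c • 1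
  adapted : ∀ t : ℝ≥0, 0 < t →
    ∃ B : FockBefore k t →L[ℂ] FockBefore k t, toFun (Icc 0 (t : ℝ≥0∞)) = tensorAt t B 1

/-- Finite partitions `{0 = π_0 < ⋯ < π_{n+1} = t}` of `[0, t]`, ordered by refinement. -/
abbrev TimePartition (t : ℝ≥0∞) : Type :=
  {π : Finset ℝ≥0∞ // 0 ∈ π ∧ t ∈ π ∧ ∀ p ∈ π, p ≤ t}

instance (t : ℝ≥0∞) : Nonempty (TimePartition t) := ⟨{0, t}, by simp, by simp, by simp⟩

instance (t : ℝ≥0∞) : IsDirectedOrder (TimePartition t) where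
  directed π π' := by
    refine ⟨⟨π.1 ∪ π'.1, Finset.mem_union_left _ π.2.1, Finset.mem_union_left _ π.2.2.1,
      fun p hp => ?_⟩, Finset.subset_union_left, Finset.subset_union_right⟩
    rcases Finset.mem_union.1 hp with h | h
    · exact π.2.2.2 p h
    · exact π'.2.2.2 p h

/-- The point of the partition preceding `p`. -/
def TimePartition.pred {t : ℝ≥0∞} (π : TimePartition t) (p : ℝ≥0∞) : ℝ≥0∞ :=
  (π.1.filter (· < p)).sup id

/-- Strong operator convergence of a net of bounded operators. -/
def StrongTendsto {ι E : Type*} [NormedAddCommGroup E] [NormedSpace ℂ E] (A : ι → E →L[ℂ] E)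
    (l : Filter ι) (T : E →L[ℂ] E) : Prop :=
  ∀ x, Tendsto (fun i => A i x) l (𝓝 (T x))

open Classical in
/-- The strong limit of a net of bounded operators (zero if there is none). -/
def strongLim {ι E : Type*} [Preorder ι] [NormedAddCommGroup E] [NormedSpace ℂ E]
    (A : ι → E →L[ℂ] E) : E →L[ℂ] E :=
  if h : ∃ T, StrongTendsto A atTop T then h.choose else 0

namespace QuantumStopTime

variable {k} (S : QuantumStopTime k)

/-- The increment `S((π_{j-1}, π_j])` at the point `p = π_j` of the partition `π`. -/
def increment {t : ℝ≥0∞} (π : TimePartition t) (p : ℝ≥0∞) : FockR k →L[ℂ] FockR k :=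
  S.toFun (Ioc (π.pred p) p)

/-- `y = ∫_{[0,t]} S(ds) v(s)`, as the limit over partitions of `∑_j S((π_{j-1}, π_j]) v(π_j)`. -/
def HasStopIntegral (t : ℝ≥0∞) (v : ℝ≥0∞ → FockR k) (y : FockR k) : Prop :=
  Tendsto (fun π : TimePartition t => ∑ p ∈ π.1.erase 0, S.increment π p (v p)) atTop (𝓝 y)

/-- `E_{S,π} = ∑_j S((π_{j-1}, π_j]) E_{π_j}`. -/
def projSum {t : ℝ≥0∞} (π : TimePartition t) : FockR k →L[ℂ] FockR k :=
  ∑ p ∈ π.1.erase 0, S.increment π p ∘L timeProj p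

/-- `E_{S,t}`, the strong limit of `E_{S,π}` over partitions `π` of `[0, t]`. -/
def proj (t : ℝ≥0∞) : FockR k →L[ℂ] FockR k :=
  strongLim fun π : TimePartition t => S.projSum π

/-- `Γ_{S,π} = ∑_j S((π_{j-1}, π_j]) Γ_{π_j}`. -/
def shiftSum (π : TimePartition ∞) : FockR k →L[ℂ] FockR k :=
  ∑ p ∈ π.1.erase 0, S.increment π p ∘L shiftOp p

/-- The stopped right shift `Γ_S`, the strong limit of `Γ_{S,π}`. -/
def shift : FockR k →L[ℂ] FockR k := strongLim S.shiftSum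

/-- `σ_{S,π}(X) = ∑_j σ_{π_j}(X) S((π_{j-1}, π_j])`. -/
def flowSum (X : FockR k →L[ℂ] FockR k) (π : TimePartition ∞) : FockR k →L[ℂ] FockR k :=
  ∑ p ∈ π.1.erase 0, ccrFlow p X ∘L S.increment π p

/-- The stopped CCR flow `σ_S(X)`, the strong limit of `σ_{S,π}(X)`. -/
def flow (X : FockR k →L[ℂ] FockR k) : FockR k →L[ℂ] FockR k := strongLim (S.flowSum X)

/-- The pre-`S` space `F_{S)}`, the range of `E_S = E_{S,∞}`. -/
def preSpace : Submodule ℂ (FockR k) := LinearMap.range (S.proj ∞).toLinearMap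

/-- The post-`S` space `F_{[S}`, the range of `Γ_S`. -/
def postSpace : Submodule ℂ (FockR k) := LinearMap.range S.shift.toLinearMap

/-- `Γ_S X Γ_S^*` as an operator on `F_{[S}`. -/
def shiftConj (X : FockR k →L[ℂ] FockR k) : S.postSpace →L[ℂ] S.postSpace :=
  ((S.shift ∘L X ∘L ContinuousLinearMap.adjoint S.shift) ∘L S.postSpace.subtypeL).codRestrict
    S.postSpace fun _ => ⟨_, rfl⟩

/-- The defining property of the strong Markov isomorphism `j_S : F_{S)} ⊗ F_{[S} → F`:
`j_S(E_{S,t} ε(f) ⊗ Γ_S x) = ∫_{[0,t]} S(ds) ε(f|_{[0,s)}) ⊗ Γ_s x` for `t ∈ (0, ∞]`. Part of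
the condition is that `E_{S,t} ε(f)` belongs to `F_{S)}` and that the integral exists. -/
def IsStrongMarkovIso (j : HTensor S.preSpace S.postSpace ≃ₗᵢ[ℂ] FockR k) : Prop :=
  ∀ t : ℝ≥0∞, 0 < t → ∀ (f : LTwo k (Ici 0)) (x : FockR k),
    ∃ (hu : S.proj t (expVec f) ∈ S.preSpace) (hv : S.shift x ∈ S.postSpace),
      S.HasStopIntegral t (expShift f x) (j (htmul ⟨S.proj t (expVec f), hu⟩ ⟨S.shift x, hv⟩))

end QuantumStopTime

end StopTime

end StoppedCCR

open StoppedCCR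

set_option linter.unusedSectionVars false

/-! All the objects are stop-time integrals of curves `s ↦ ε(f|_{[0,s)}) ⊗ Γ_s y(s)` with `y`
bounded and continuous. The choice `y = ε(0)` gives `E_S ε(f)`; `f = 0`, `y = x` gives `Γ_S x`; and
`y(s) = X ε(θ_s^* f)` gives `σ_S(X) ε(f)`. The value of an integrand at `∞` is immaterial for finite
`S`.

Existence (`exists_hasStopIntegral`). An increment `S((a,q])` acts on the factor `F_{q)}` alone, so
on a vector `w = ε(f|_{[0,q)}) ⊗ b` its norm is at most `‖w‖ ‖S((a,q]) ε(f)‖`. A value of the curve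
at a later time `p ≥ q` still has this form, so evaluating at `p` instead of `q` costs at most `η
‖S((a,q]) ε(f)‖` if the curve moves by at most `η`. Increments over disjoint cells are orthogonal,
so these errors add up to at most `η ‖ε(f)‖`. Uniform continuity on `[0,n]` makes `η` small, and
finiteness of `S` disposes of the times after `n`. Thus the partition sums form a Cauchy net.

Strong Markov property (`inner_hasStopIntegral_expShift`). By the same tensor structure, `x` and `y`
enter each term of the inner product of two partition sums only through `⟨x, y⟩`. Write `J(f,x)` for
the integral with constant `y = x`. In the limit `⟨J(f,x), J(g,y)⟩ = ⟨E_S ε(f), E_S ε(g)⟩ ⟨x, y⟩`,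
also with `S([0,m])` inserted. Hence `Γ_S` is isometric, and `E_S ε(f) ⊗ Γ_S x ↦ J(f,x)` preserves
inner products. Integrals over `[0,t]` are `S([0,t])` applied to integrals over `[0,∞]`
(`HasStopIntegral.restrict`), which covers all `t`. For surjectivity
(`expVec_mem_of_hasStopIntegral_mem`), `ε(f)` is the integral with `y(s) = ε(θ_s^* f)`; freezing `y`
on the cells of a partition approximates it by sums of vectors `S((a,b]) J(f,x)`.

The flow formula holds because `σ_s(X)` replaces `x` by `X x` in the integrand, so that `σ_S(X)
J(f,x) = J(f, X x)` (`hasStopIntegral_flow`). -/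

namespace StoppedCCR

/-! ### Strong continuity of shifts and cut-offs on `L²`. -/

section Shifts

variable {k : Type*} [NormedAddCommGroup k] [InnerProductSpace ℂ k]

lemma LTwo.eq_extend_add_extend (t : ℝ≥0) (f : LTwo k (Ici 0)) :
    f = LTwo.extend measurableSet_Ico (Ico_sub t) (LTwo.restrict (Ico_sub t) f) +
      LTwo.extend measurableSet_Ici (Ici_sub t) (LTwo.restrict (Ici_sub t) f) := by
  refine Lp.ext ?_
  have h1 := (ae_restrict_iff' measurableSet_Ico).1 (LTwo.coeFn_restrict (Ico_sub t) f)
  have h2 := (ae_restrict_iff' measurableSet_Ici).1 (LTwo.coeFn_restrict (Ici_sub t) f)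
  filter_upwards [Lp.coeFn_add
      (LTwo.extend measurableSet_Ico (Ico_sub t) (LTwo.restrict (Ico_sub t) f))
      (LTwo.extend measurableSet_Ici (Ici_sub t) (LTwo.restrict (Ici_sub t) f)),
    LTwo.coeFn_extend measurableSet_Ico (Ico_sub t) (LTwo.restrict (Ico_sub t) f),
    LTwo.coeFn_extend measurableSet_Ici (Ici_sub t) (LTwo.restrict (Ici_sub t) f),
    ae_mono Measure.restrict_le_self h1, ae_mono Measure.restrict_le_self h2,
    ae_restrict_mem measurableSet_Ici] with s a1 a2 a3 a4 a5 a6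
  rw [a1, Pi.add_apply, a2, a3]
  rcases lt_or_ge s (t : ℝ) with h | h
  · rw [indicator_of_mem (show s ∈ Ico 0 (t : ℝ) from ⟨a6, h⟩), a4 ⟨a6, h⟩,
      indicator_of_notMem (by simpa using h), add_zero]
  · rw [indicator_of_notMem (fun h' => absurd h'.2 (not_lt.2 h)), zero_add,
      indicator_of_mem (show s ∈ Ici (t : ℝ) from h), a5 h]

lemma measurePreserving_add_univ (s : ℝ) :
    MeasurePreserving (fun u : ℝ => u + s) (volume.restrict univ) (volume.restrict univ) := by
  simpa using measurePreserving_add_right (volume : Measure ℝ) s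

/-- The regularity of the measure on which continuity of translations in `L²` rests. -/
instance : (volume.restrict (univ : Set ℝ)).InnerRegularCompactLTTop := by
  rw [Measure.restrict_univ]; infer_instance

/-- Translation of functions on the line. -/
def translate (s : ℝ) (f : LTwo k univ) : LTwo k univ :=
  Lp.compMeasurePreserving (fun u : ℝ => u + s) (measurePreserving_add_univ s) f

lemma continuous_translate (f : LTwo k univ) : Continuous fun s : ℝ => translate s f := by
  have hF : Continuous fun s : ℝ => (ContinuousMap.mk (fun u : ℝ => u + s) (by fun_prop)) := by
    have : Continuous fun p : ℝ × ℝ => p.2 + p.1 := by fun_prop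
    exact ((ContinuousMap.mk _ this).curry).continuous
  exact (continuous_const (y := f)).compMeasurePreservingLp hF
    (fun s => measurePreserving_add_univ s) (by simp)

lemma coeFn_translate (s : ℝ) (f : LTwo k univ) :
    translate s f =ᵐ[volume.restrict univ] fun u => f (u + s) := by
  exact Lp.coeFn_compMeasurePreserving f (measurePreserving_add_univ s)

/-- The left shift `(θ_t^* f)(s) = f(s + t)` on `L²(ℝ₊; k)`. -/
def leftShift (t : ℝ≥0) (f : LTwo k (Ici 0)) : LTwo k (Ici 0) :=
  LTwo.restrict (subset_univ _)
    (translate t (LTwo.extend measurableSet_Ici (subset_univ (Ici (0 : ℝ))) f))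

lemma continuous_leftShift (f : LTwo k (Ici 0)) : Continuous fun t : ℝ≥0 => leftShift t f :=
  (LTwo.restrict _).continuous.comp ((continuous_translate _).comp NNReal.continuous_coe)

lemma coeFn_leftShift (t : ℝ≥0) (f : LTwo k (Ici 0)) :
    leftShift t f =ᵐ[volume.restrict (Ici 0)] fun s => f (s + t) := by
  have h1 := coeFn_translate (t : ℝ)
    (LTwo.extend measurableSet_Ici (subset_univ (Ici (0 : ℝ))) f)
  have h2 := LTwo.coeFn_extend measurableSet_Ici (subset_univ (Ici (0 : ℝ))) f
  have h3 := (measurePreserving_add_univ (t : ℝ)).quasiMeasurePreserving.ae_eq_comp h2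
  filter_upwards [LTwo.coeFn_restrict (subset_univ (Ici (0 : ℝ)))
      (translate t (LTwo.extend measurableSet_Ici (subset_univ (Ici (0 : ℝ))) f)),
    ae_mono (Measure.restrict_mono_set _ (subset_univ (Ici (0 : ℝ)))) h1,
    ae_mono (Measure.restrict_mono_set _ (subset_univ (Ici (0 : ℝ)))) h3,
    ae_restrict_mem measurableSet_Ici] with s a1 a2 a3 a4
  rw [leftShift, a1, a2]
  refine a3.trans ?_
  exact indicator_of_mem (show s + (t : ℝ) ∈ Ici 0 from add_nonneg a4 t.2) _

lemma shiftTo_leftShift (t : ℝ≥0) (f : LTwo k (Ici 0)) :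
    shiftTo t (leftShift t f) = LTwo.restrict (Ici_sub t) f := by
  refine Lp.ext ?_
  have h1 := (measurePreserving_sub_Ici (t : ℝ)).quasiMeasurePreserving.ae_eq_comp
    (coeFn_leftShift t f)
  filter_upwards [Lp.coeFn_compMeasurePreserving (leftShift t f) (measurePreserving_sub_Ici (t : ℝ)),
    h1, LTwo.coeFn_restrict (Ici_sub t) f] with s a1 a2 a3
  refine a1.trans (a2.trans ?_)
  rw [a3]
  simp

/-- Passing to the whole line turns the shift into a translation, whose strong continuity is known.
-/
lemma rightShift_eq_restrict_translate (t : ℝ≥0) (f : LTwo k (Ici 0)) :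
    rightShift t f = LTwo.restrict (subset_univ _)
      (translate (-t) (LTwo.extend measurableSet_Ici (subset_univ (Ici (0 : ℝ))) f)) := by
  refine Lp.ext ?_
  have h1 := coeFn_translate (-t : ℝ)
    (LTwo.extend measurableSet_Ici (subset_univ (Ici (0 : ℝ))) f)
  have h2 := LTwo.coeFn_extend measurableSet_Ici (subset_univ (Ici (0 : ℝ))) f
  have h3 := (measurePreserving_add_univ (-t : ℝ)).quasiMeasurePreserving.ae_eq_comp h2
  have h4 := (ae_restrict_iff' measurableSet_Ici).1
    (Lp.coeFn_compMeasurePreserving f (measurePreserving_sub_Ici (t : ℝ)))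
  filter_upwards [LTwo.coeFn_restrict (subset_univ (Ici (0 : ℝ)))
      (translate (-t) (LTwo.extend measurableSet_Ici (subset_univ (Ici (0 : ℝ))) f)),
    ae_mono (Measure.restrict_mono_set _ (subset_univ (Ici (0 : ℝ)))) h1,
    ae_mono (Measure.restrict_mono_set _ (subset_univ (Ici (0 : ℝ)))) h3,
    ae_mono Measure.restrict_le_self h4,
    LTwo.coeFn_extend measurableSet_Ici (Ici_sub t) (shiftTo t f)] with s a1 a2 a3 a4 a5
  rw [a1, a2]
  refine a5.trans (Eq.trans ?_ a3.symm)
  rcases lt_or_ge s (t : ℝ) with h | h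
  · rw [indicator_of_notMem (by simpa using h)]
    exact (indicator_of_notMem (by simpa using h) _).symm
  · rw [indicator_of_mem (show s ∈ Ici (t : ℝ) from h)]
    refine (a4 h).trans (Eq.trans ?_ (indicator_of_mem (by simpa using h) _).symm)
    rw [Function.comp, sub_eq_add_neg]

lemma continuous_rightShift (f : LTwo k (Ici 0)) : Continuous fun t : ℝ≥0 => rightShift t f := by
  simp only [rightShift_eq_restrict_translate]
  exact (LTwo.restrict _).continuous.comp
    ((continuous_translate _).comp NNReal.continuous_coe.neg)

/-- `1_{[0,t)} f`. -/
def cutoff (t : ℝ≥0) (f : LTwo k (Ici 0)) : LTwo k (Ici 0) :=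
  LTwo.extend measurableSet_Ico (Ico_sub t) (LTwo.restrict (Ico_sub t) f)

lemma cutoff_add_rightShift (t : ℝ≥0) (f : LTwo k (Ici 0)) :
    cutoff t f + rightShift t (leftShift t f) = f := by
  conv_rhs => rw [LTwo.eq_extend_add_extend t f]
  rw [← shiftTo_leftShift]
  rfl

lemma continuous_cutoff (f : LTwo k (Ici 0)) : Continuous fun t : ℝ≥0 => cutoff t f := by
  have h : ∀ t, cutoff t f = f - rightShift t (leftShift t f) := fun t =>
    eq_sub_of_add_eq (cutoff_add_rightShift t f)
  simp only [h]
  refine continuous_const.sub ?_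
  rw [continuous_iff_continuousAt]
  intro t
  have h1 : Tendsto (fun s : ℝ≥0 => rightShift s (leftShift t f)) (𝓝 t)
      (𝓝 (rightShift t (leftShift t f))) := (continuous_rightShift _).tendsto t
  -- Both factors of `θ_s θ_s^*` vary with `s`; since `θ_s` is isometric, moving its argument costs
  -- only the norm of the displacement.
  have h2 : Tendsto (fun s : ℝ≥0 => rightShift s (leftShift s f - leftShift t f)) (𝓝 t) (𝓝 0) := by
    rw [tendsto_zero_iff_norm_tendsto_zero]
    simp only [LinearIsometry.norm_map]
    exact tendsto_iff_norm_sub_tendsto_zero.1 ((continuous_leftShift f).tendsto t)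
  refine ((h2.add h1).congr fun s => ?_).trans (by rw [zero_add])
  rw [← map_add, sub_add_cancel]

end Shifts

end StoppedCCR

namespace StoppedCCR

/-! ### Total families, tensor products and exponential vectors. -/

section General

variable {E F : Type*} [NormedAddCommGroup E] [InnerProductSpace ℂ E]
  [NormedAddCommGroup F] [InnerProductSpace ℂ F]

lemma ext_of_total {ι : Type*} {φ : ι → E} (hφ : Total φ) {A B : E →L[ℂ] F}
    (h : ∀ i, A (φ i) = B (φ i)) : A = B := by
  ext x
  refine mem_of_total hφ (LinearMap.eqLocus A.toLinearMap B.toLinearMap) ?_ h x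
  exact isClosed_eq A.continuous B.continuous

lemma ext_inner_of_total {ι κ : Type*} {φ : ι → E} {ψ : κ → F} (hφ : Total φ) (hψ : Total ψ)
    {A B : E →L[ℂ] F} (h : ∀ i j, inner ℂ (ψ j) (A (φ i)) = inner ℂ (ψ j) (B (φ i))) : A = B := by
  refine ext_of_total hφ fun i => ?_
  refine ext_inner_left ℂ fun y => ?_
  have hK : IsClosed {y : F | inner ℂ y (A (φ i)) = inner ℂ y (B (φ i))} :=
    isClosed_eq (by fun_prop) (by fun_prop)
  refine mem_of_total hψ
    { carrier := {y : F | inner ℂ y (A (φ i)) = inner ℂ y (B (φ i))}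
      add_mem' := fun {a b} ha hb => by
        simp only [mem_ofPred_eq] at *
        rw [inner_add_left, inner_add_left, ha, hb]
      zero_mem' := by simp
      smul_mem' := fun c a ha => by
        simp only [mem_ofPred_eq] at *
        rw [inner_smul_left, inner_smul_left, ha] } hK (fun j => h i j) y

/-- A bounded family of operators that tends to zero on a total set tends to zero strongly. -/
lemma tendsto_zero_of_total {ι κ : Type*} {l : Filter ι} {φ : κ → E} (hφ : Total φ)
    {T : ι → E →L[ℂ] F} {C : ℝ} (hT : ∀ i, ‖T i‖ ≤ C)
    (h : ∀ j, Tendsto (fun i => T i (φ j)) l (𝓝 0)) (x : E) :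
    Tendsto (fun i => T i x) l (𝓝 0) := by
  refine mem_of_total hφ
    { carrier := {x : E | Tendsto (fun i => T i x) l (𝓝 0)}
      add_mem' := fun {a b} ha hb => by
        simp only [mem_ofPred_eq, map_add] at *
        simpa using ha.add hb
      zero_mem' := by simpa using tendsto_const_nhds
      smul_mem' := fun c a ha => by
        simp only [mem_ofPred_eq, map_smul] at *
        simpa using ha.const_smul c } ?_ h x
  refine isClosed_of_closure_subset fun x hx => ?_
  change Tendsto (fun i => T i x) l (𝓝 0)
  rw [Metric.tendsto_nhds]
  intro ε hε
  have hC : 0 < |C| + 1 := by positivity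
  obtain ⟨y, hy, hxy⟩ := Metric.mem_closure_iff.1 hx (ε / 2 / (|C| + 1)) (by positivity)
  have hy' : Tendsto (fun i => T i y) l (𝓝 0) := hy
  filter_upwards [Metric.tendsto_nhds.1 hy' (ε / 2) (by positivity)] with i hi
  rw [dist_zero_right] at *
  have h1 : ‖T i (x - y)‖ ≤ (|C| + 1) * ‖x - y‖ :=
    (T i).le_of_opNorm_le ((hT i).trans ((le_abs_self C).trans (by linarith))) _
  have h2 : (|C| + 1) * ‖x - y‖ < ε / 2 := by
    rw [dist_eq_norm] at hxy
    rw [mul_comm]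
    exact (lt_div_iff₀ hC).1 hxy
  calc ‖T i x‖ = ‖T i (x - y) + T i y‖ := by rw [← map_add, sub_add_cancel]
    _ ≤ ‖T i (x - y)‖ + ‖T i y‖ := norm_add_le _ _
    _ < ε := by linarith

/-- The Cauchy property is convergence to zero of the differences along `l ×ˢ l`, so
`tendsto_zero_of_total` applies. -/
lemma exists_tendsto_of_total [CompleteSpace F] {ι κ : Type*} {l : Filter ι} [l.NeBot] {φ : κ → E}
    (hφ : Total φ) {T : ι → E →L[ℂ] F} {C : ℝ} (hT : ∀ i, ‖T i‖ ≤ C)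
    (h : ∀ j, ∃ y, Tendsto (fun i => T i (φ j)) l (𝓝 y)) (x : E) :
    ∃ y, Tendsto (fun i => T i x) l (𝓝 y) := by
  have key : Tendsto (fun p : ι × ι => (T p.1 - T p.2) x) (l ×ˢ l) (𝓝 0) := by
    refine tendsto_zero_of_total hφ (C := C + C)
      (fun p => (norm_sub_le _ _).trans (add_le_add (hT _) (hT _))) (fun j => ?_) x
    obtain ⟨y, hy⟩ := h j
    simpa using (hy.comp tendsto_fst).sub (hy.comp tendsto_snd)
  refine cauchy_map_iff_exists_tendsto.1 (cauchy_map_iff.2 ⟨inferInstance, ?_⟩)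
  rw [uniformity_eq_comap_nhds_zero_swapped, tendsto_comap_iff]
  exact key

lemma continuous_of_total {X κ : Type*} [TopologicalSpace X] {φ : κ → E} (hφ : Total φ)
    {T : X → E →L[ℂ] F} {C : ℝ} (hT : ∀ i, ‖T i‖ ≤ C)
    (h : ∀ j, Continuous fun i => T i (φ j)) : Continuous fun p : X × E => T p.1 p.2 := by
  rw [continuous_iff_continuousAt]
  rintro ⟨s, x⟩
  have h1 : Tendsto (fun r => (T r - T s) x) (𝓝 s) (𝓝 0) := by
    refine tendsto_zero_of_total hφ (C := C + C)
      (fun p => (norm_sub_le _ _).trans (add_le_add (hT _) (hT _))) (fun j => ?_) x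
    simpa using ((h j).tendsto s).sub_const (T s (φ j))
  have h2 : Tendsto (fun p : X × E => T p.1 (p.2 - x)) (𝓝 (s, x)) (𝓝 0) := by
    have h3 : Tendsto (fun p : X × E => C * ‖p.2 - x‖) (𝓝 (s, x)) (𝓝 0) := by
      have : Continuous fun p : X × E => C * ‖p.2 - x‖ := by fun_prop
      simpa using this.tendsto (s, x)
    exact squeeze_zero_norm (fun p => (T p.1).le_of_opNorm_le (hT _) _) h3
  have h4 := (h1.comp (continuous_fst.tendsto (s, x))).add h2
  have h5 := h4.add_const (T s x)
  refine (h5.congr fun p => ?_).trans (by simp)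
  simp

lemma HTensor.norm_map_le {G H : Type*} [NormedAddCommGroup G] [InnerProductSpace ℂ G]
    [NormedAddCommGroup H] [InnerProductSpace ℂ H] (A : E →L[ℂ] G) (B : F →L[ℂ] H) :
    ‖HTensor.map A B‖ ≤ ‖A‖ * ‖B‖ := by
  refine ContinuousLinearMap.opNorm_le_bound _ (by positivity) fun x => ?_
  refine UniformSpace.Completion.induction_on x
    (isClosed_le (HTensor.map A B).continuous.norm (continuous_const.mul continuous_norm)) fun a => ?_
  rw [HTensor.map, ContinuousLinearMap.completion_apply_coe, UniformSpace.Completion.norm_coe,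
    UniformSpace.Completion.norm_coe]
  exact (TensorProduct.mapL A B).le_of_opNorm_le (TensorProduct.norm_mapL_le A B) a

lemma norm_htmul (x : E) (y : F) : ‖htmul x y‖ = ‖x‖ * ‖y‖ := by
  simp [htmul]

lemma total_htmul_all : Total (fun p : E × F => htmul p.1 p.2) := by
  refine total_htmul (φ := fun x : E => x) (ψ := fun x : F => x) ?_ ?_ <;>
  · rw [Total]; simp

lemma HTensor.map_comp_map {G H E' F' : Type*} [NormedAddCommGroup G] [InnerProductSpace ℂ G]
    [NormedAddCommGroup H] [InnerProductSpace ℂ H] [NormedAddCommGroup E'] [InnerProductSpace ℂ E']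
    [NormedAddCommGroup F'] [InnerProductSpace ℂ F'] (A : E →L[ℂ] G) (B : F →L[ℂ] H)
    (A' : E' →L[ℂ] E) (B' : F' →L[ℂ] F) :
    HTensor.map A B ∘L HTensor.map A' B' = HTensor.map (A ∘L A') (B ∘L B') :=
  ext_of_total total_htmul_all fun p => by simp [HTensor.map_htmul]

/-- The squared distance of two exponential vectors is a combination of exponentials of inner
products. -/
lemma continuous_expVec {H : Type*} [NormedAddCommGroup H] [InnerProductSpace ℂ H] :
    Continuous (expVec : H → Fock H) := by
  rw [continuous_iff_continuousAt]
  intro f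
  rw [ContinuousAt, tendsto_iff_norm_sub_tendsto_zero]
  have h1 : ∀ g : H, ‖expVec g - expVec f‖ ^ 2 =
      (Complex.exp (inner ℂ g g) - Complex.exp (inner ℂ f g) - Complex.exp (inner ℂ g f) +
        Complex.exp (inner ℂ f f)).re := by
    intro g
    rw [@norm_sq_eq_re_inner ℂ]
    simp only [inner_sub_left, inner_sub_right, inner_expVec]
    simp only [map_sub, Complex.sub_re, Complex.add_re, RCLike.re_to_complex]
    ring
  have h2 : Tendsto (fun g : H => ‖expVec g - expVec f‖ ^ 2) (𝓝 f) (𝓝 0) := by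
    have h3 : Continuous fun g : H => (Complex.exp (inner ℂ g g) - Complex.exp (inner ℂ f g) -
      Complex.exp (inner ℂ g f) + Complex.exp (inner ℂ f f)).re := by fun_prop
    simp only [h1]
    simpa using h3.tendsto f
  simpa using h2.sqrt

lemma vacuumProj_expVec {H : Type*} [NormedAddCommGroup H] [InnerProductSpace ℂ H] (f : H) :
    vacuumProj H (expVec f) = expVec 0 := by
  have h : ‖expVec (0 : H)‖ = 1 := by
    have := inner_expVec (0 : H) 0
    rw [inner_self_eq_norm_sq_to_K, inner_zero_left, Complex.exp_zero] at this
    have h2 : ‖expVec (0 : H)‖ ^ 2 = 1 := by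
      apply Complex.ofReal_injective
      push_cast
      exact this
    nlinarith [norm_nonneg (expVec (0 : H))]
  rw [vacuumProj, Submodule.starProjection_unit_singleton ℂ h, inner_expVec]
  simp

/-- From `‖ε(f)‖² = exp ‖f‖²`. In a norm estimate an exponential tensor factor may therefore be
inserted at no cost. -/
lemma one_le_norm_expVec {H : Type*} [NormedAddCommGroup H] [InnerProductSpace ℂ H] (f : H) :
    1 ≤ ‖expVec f‖ := by
  have h1 := inner_expVec f f
  rw [inner_self_eq_norm_sq_to_K, inner_self_eq_norm_sq_to_K] at h1
  have h2 : ‖expVec f‖ ^ 2 = Real.exp (‖f‖ ^ 2) := by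
    apply Complex.ofReal_injective
    push_cast
    exact h1
  have h3 : 1 ≤ ‖expVec f‖ ^ 2 := by rw [h2]; exact Real.one_le_exp (by positivity)
  nlinarith [norm_nonneg (expVec f)]

end General

/-! ### The vectors `ε(f|_{[0,t)}) ⊗ Γ_t x` and operators adapted at time `t`. -/

section Tensor

variable {k : Type*} [NormedAddCommGroup k] [InnerProductSpace ℂ k]

/-- The vector of `F` identified with `a ⊗ b ∈ F_{t)} ⊗ F_{[t}`. -/
def splitMul (t : ℝ≥0) (a : FockBefore k t) (b : FockAfter k t) : FockR k :=
  (split t).symm (htmul a b)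

lemma inner_splitMul (t : ℝ≥0) (a a' : FockBefore k t) (b b' : FockAfter k t) :
    inner ℂ (splitMul t a b) (splitMul t a' b') = inner ℂ a a' * inner ℂ b b' := by
  rw [splitMul, splitMul, LinearIsometryEquiv.inner_map_map, inner_htmul]

lemma norm_splitMul (t : ℝ≥0) (a : FockBefore k t) (b : FockAfter k t) :
    ‖splitMul t a b‖ = ‖a‖ * ‖b‖ := by
  rw [splitMul, LinearIsometryEquiv.norm_map, norm_htmul]

/-- `b ↦ a ⊗ b` as a bounded operator. -/
def splitMulLeft (t : ℝ≥0) (a : FockBefore k t) : FockAfter k t →L[ℂ] FockR k :=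
  ((split (k := k) t).symm : HTensor (FockBefore k t) (FockAfter k t) →L[ℂ] FockR k) ∘L htmulL a

/-- `a ↦ a ⊗ b` as a bounded operator. -/
def splitMulRight (t : ℝ≥0) (b : FockAfter k t) : FockBefore k t →L[ℂ] FockR k :=
  ((split (k := k) t).symm : HTensor (FockBefore k t) (FockAfter k t) →L[ℂ] FockR k) ∘L
    htmulL.flip b

lemma splitMulRight_apply (t : ℝ≥0) (a : FockBefore k t) (b : FockAfter k t) :
    splitMulRight t b a = splitMul t a b := rfl

lemma tensorAt_splitMul (t : ℝ≥0) (A : FockBefore k t →L[ℂ] FockBefore k t)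
    (B : FockAfter k t →L[ℂ] FockAfter k t) (a : FockBefore k t) (b : FockAfter k t) :
    tensorAt t A B (splitMul t a b) = splitMul t (A a) (B b) := by
  simp [tensorAt, splitMul, HTensor.map_htmul]

lemma tensorAt_comp (t : ℝ≥0) (A A' : FockBefore k t →L[ℂ] FockBefore k t)
    (B B' : FockAfter k t →L[ℂ] FockAfter k t) :
    tensorAt t A B ∘L tensorAt t A' B' = tensorAt t (A ∘L A') (B ∘L B') := by
  ext x
  have h := congrArg (fun T => T (split t x)) (HTensor.map_comp_map A B A' B')
  simp only [ContinuousLinearMap.comp_apply] at h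
  simp [tensorAt, h]

lemma norm_tensorAt_le (t : ℝ≥0) (A : FockBefore k t →L[ℂ] FockBefore k t)
    (B : FockAfter k t →L[ℂ] FockAfter k t) : ‖tensorAt t A B‖ ≤ ‖A‖ * ‖B‖ := by
  refine ContinuousLinearMap.opNorm_le_bound _ (by positivity) fun x => ?_
  have h := (HTensor.map A B).le_of_opNorm_le (HTensor.norm_map_le A B) (split t x)
  simpa [tensorAt] using h

lemma splitMul_expVec_restrict (t : ℝ≥0) (f : LTwo k (Ici 0)) :
    splitMul t (expVec (LTwo.restrict (Ico_sub t) f)) (expVec (LTwo.restrict (Ici_sub t) f)) =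
      expVec f := by
  rw [splitMul, ← split_expVec, LinearIsometryEquiv.symm_apply_apply]

lemma restrict_extend_add_extend (t : ℝ≥0) (u : LTwo k (Ico 0 (t : ℝ))) (v : LTwo k (Ici (t : ℝ))) :
    LTwo.restrict (Ico_sub t) (LTwo.extend measurableSet_Ico (Ico_sub t) u +
      LTwo.extend measurableSet_Ici (Ici_sub t) v) = u ∧
    LTwo.restrict (Ici_sub t) (LTwo.extend measurableSet_Ico (Ico_sub t) u +
      LTwo.extend measurableSet_Ici (Ici_sub t) v) = v := by
  obtain ⟨f, rfl, rfl⟩ := restrict_glue t u v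
  rw [← LTwo.eq_extend_add_extend]
  exact ⟨rfl, rfl⟩

lemma splitMul_expVec (t : ℝ≥0) (u : LTwo k (Ico 0 (t : ℝ))) (v : LTwo k (Ici (t : ℝ))) :
    splitMul t (expVec u) (expVec v) = expVec (LTwo.extend measurableSet_Ico (Ico_sub t) u +
      LTwo.extend measurableSet_Ici (Ici_sub t) v) := by
  rw [← splitMul_expVec_restrict t, (restrict_extend_add_extend t u v).1,
    (restrict_extend_add_extend t u v).2]

lemma splitMul_expVec_zero (t : ℝ≥0) (f : LTwo k (Ici 0)) :
    splitMul t (expVec (LTwo.restrict (Ico_sub t) f)) (expVec 0) = expVec (cutoff t f) := by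
  rw [splitMul_expVec, map_zero, add_zero, cutoff]

lemma shiftOpTo_expVec (t : ℝ≥0) (f : LTwo k (Ici 0)) :
    shiftOpTo t (expVec f) = expVec (shiftTo t f) :=
  secondQuantisation_expVec _ _

lemma shiftOpTo_apply (t : ℝ≥0) (x : FockR k) :
    shiftOpTo t x = secondQuantisation (shiftTo (k := k) t) x := rfl

lemma norm_shiftOpTo (t : ℝ≥0) (x : FockR k) : ‖shiftOpTo t x‖ = ‖x‖ := by
  rw [shiftOpTo_apply, LinearIsometry.norm_map]

lemma inner_shiftOpTo (t : ℝ≥0) (x y : FockR k) :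
    inner ℂ (shiftOpTo t x) (shiftOpTo t y) = inner ℂ x y := by
  rw [shiftOpTo_apply, shiftOpTo_apply, LinearIsometry.inner_map_map]

/-- `x ↦ ε(f|_{[0,s)}) ⊗ Γ_s x` as a bounded operator, for `s < ∞`. -/
def expShiftL (f : LTwo k (Ici 0)) (s : ℝ≥0) : FockR k →L[ℂ] FockR k :=
  splitMulLeft s (expVec (LTwo.restrict (Ico_sub s) f)) ∘L shiftOpTo s

lemma expShiftL_apply (f : LTwo k (Ici 0)) (s : ℝ≥0) (x : FockR k) :
    expShiftL f s x = splitMul s (expVec (LTwo.restrict (Ico_sub s) f)) (shiftOpTo s x) := rfl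

lemma expShift_coe (f : LTwo k (Ici 0)) (x : FockR k) (s : ℝ≥0) :
    expShift f x s = expShiftL f s x := by
  rw [expShift, if_neg ENNReal.coe_ne_top]
  rfl

lemma expShift_top (f : LTwo k (Ici 0)) (x : FockR k) : expShift f x ∞ = expVec f := if_pos rfl

lemma expShiftL_expVec (f g : LTwo k (Ici 0)) (s : ℝ≥0) :
    expShiftL f s (expVec g) = expVec (cutoff s f + rightShift s g) := by
  rw [expShiftL_apply, shiftOpTo_expVec, splitMul_expVec]
  rfl

lemma norm_restrict_expVec_le (f : LTwo k (Ici 0)) (s : ℝ≥0) :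
    ‖expVec (LTwo.restrict (Ico_sub s) f)‖ ≤ ‖expVec f‖ := by
  rw [← splitMul_expVec_restrict s f, norm_splitMul]
  exact le_mul_of_one_le_right (norm_nonneg _) (one_le_norm_expVec _)

lemma norm_expShiftL_le (f : LTwo k (Ici 0)) (s : ℝ≥0) : ‖expShiftL f s‖ ≤ ‖expVec f‖ := by
  refine ContinuousLinearMap.opNorm_le_bound _ (by positivity) fun x => ?_
  rw [expShiftL_apply, norm_splitMul, norm_shiftOpTo]
  exact mul_le_mul_of_nonneg_right (norm_restrict_expVec_le f s) (norm_nonneg _)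

lemma continuous_expShiftL (f : LTwo k (Ici 0)) :
    Continuous fun p : ℝ≥0 × FockR k => expShiftL f p.1 p.2 := by
  refine continuous_of_total total_expVec (norm_expShiftL_le f) fun g => ?_
  simp only [expShiftL_expVec]
  exact continuous_expVec.comp ((continuous_cutoff f).add (continuous_rightShift g))

/-- At every time `ε(f)` itself is of the form `ε(f|_{[0,s)}) ⊗ Γ_s y(s)`, with `y` continuous in
`s`. Both the existence of `σ_S(X)` and the surjectivity of `j_S` depend on this. -/
lemma expShiftL_leftShift (f : LTwo k (Ici 0)) (s : ℝ≥0) :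
    expShiftL f s (expVec (leftShift s f)) = expVec f := by
  rw [expShiftL_expVec, cutoff_add_rightShift]

lemma timeProj_coe (s : ℝ≥0) :
    timeProj (k := k) s = tensorAt s 1 (vacuumProj (LTwo k (Ici (s : ℝ)))) := by
  rw [timeProj, if_neg ENNReal.coe_ne_top]
  rfl

lemma timeProj_top : timeProj (k := k) ∞ = 1 := if_pos rfl

lemma timeProj_expVec (s : ℝ≥0) (f : LTwo k (Ici 0)) :
    timeProj s (expVec f) = expShiftL f s (expVec 0) := by
  rw [timeProj_coe, ← splitMul_expVec_restrict s f, tensorAt_splitMul, vacuumProj_expVec, expShiftL_apply,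
    shiftOpTo_expVec, map_zero]
  rfl

/-- Makes the integral for `Γ_S` the case `f = 0` of the general one. -/
lemma shiftOp_coe (s : ℝ≥0) : shiftOp (k := k) s = expShiftL 0 s := by
  refine ext_of_total total_expVec fun f => ?_
  rw [shiftOp, if_neg ENNReal.coe_ne_top, expShiftL_expVec]
  simp only [ENNReal.toNNReal_coe]
  rw [cutoff, map_zero, map_zero, zero_add]
  exact secondQuantisation_expVec _ _

/-- Operators of the form `B ⊗ I` with `B ∈ B(F_{t)})`. -/
def AdaptedAt (t : ℝ≥0) (T : FockR k →L[ℂ] FockR k) : Prop :=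
  ∃ B : FockBefore k t →L[ℂ] FockBefore k t, T = tensorAt t B 1

lemma AdaptedAt.comp_tensorAt {t : ℝ≥0} {T : FockR k →L[ℂ] FockR k} (hT : AdaptedAt t T)
    (B : FockAfter k t →L[ℂ] FockAfter k t) : T ∘L tensorAt t 1 B = tensorAt t 1 B ∘L T := by
  obtain ⟨A, rfl⟩ := hT
  rw [tensorAt_comp, tensorAt_comp]
  rfl

lemma adaptedAt_zero (t : ℝ≥0) : AdaptedAt (k := k) t 0 :=
  ⟨0, by
    refine ext_of_total total_expVec fun f => ?_
    rw [← splitMul_expVec_restrict t f, tensorAt_splitMul, zero_apply,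
      zero_apply, ← splitMulRight_apply, map_zero]⟩

lemma AdaptedAt.sub {t : ℝ≥0} {T T' : FockR k →L[ℂ] FockR k} (hT : AdaptedAt t T)
    (hT' : AdaptedAt t T') : AdaptedAt t (T - T') := by
  obtain ⟨B, rfl⟩ := hT
  obtain ⟨B', rfl⟩ := hT'
  refine ⟨B - B', ext_of_total total_expVec fun f => ?_⟩
  rw [← splitMul_expVec_restrict t f, sub_apply, tensorAt_splitMul,
    tensorAt_splitMul, tensorAt_splitMul, sub_apply, ← splitMulRight_apply,
    ← splitMulRight_apply, ← splitMulRight_apply, map_sub]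

lemma restrict_cutoff_of_le {s t : ℝ≥0} (h : s ≤ t) (f : LTwo k (Ici 0)) :
    LTwo.restrict (Ico_sub s) (cutoff t f) = LTwo.restrict (Ico_sub s) f := by
  have hsub : Ico 0 (s : ℝ) ⊆ Ico 0 (t : ℝ) := Ico_subset_Ico_right (by exact_mod_cast h)
  refine Lp.ext ?_
  filter_upwards [LTwo.coeFn_restrict (Ico_sub s) (cutoff t f), LTwo.coeFn_restrict (Ico_sub s) f,
    ae_mono (Measure.restrict_mono_set _ (Ico_sub s))
      (LTwo.coeFn_extend measurableSet_Ico (Ico_sub t) (LTwo.restrict (Ico_sub t) f)),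
    ae_mono (Measure.restrict_mono_set _ hsub) (LTwo.coeFn_restrict (Ico_sub t) f),
    ae_restrict_mem measurableSet_Ico] with u a1 a2 a3 a4 a5
  rw [a1, a2, cutoff, a3, indicator_of_mem (hsub a5), a4]

variable [CompleteSpace k]

/-- The operator on `F_{t)}` is the compression of `T` by the isometry `a ↦ a ⊗ ε(0)`. That it works
is checked on matrix elements between exponential vectors, which avoids an identification of
`F_{t)}` with a tensor product. -/
lemma AdaptedAt.mono {s t : ℝ≥0} (h : s ≤ t) {T : FockR k →L[ℂ] FockR k} (hT : AdaptedAt s T) :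
    AdaptedAt t T := by
  obtain ⟨B, hB⟩ := hT
  set V := splitMulRight (k := k) t (expVec 0) with hV
  refine ⟨ContinuousLinearMap.adjoint V ∘L T ∘L V,
    ext_inner_of_total total_expVec total_expVec fun f g => ?_⟩
  have hVe : ∀ f : LTwo k (Ici 0), V (expVec (LTwo.restrict (Ico_sub t) f)) = expVec (cutoff t f) :=
    fun f => splitMul_expVec_zero t f
  -- The matrix element depends on the restrictions to `[0,s)`, times the exponential of the inner
  -- product over `[s,∞)`; the latter is written as a difference so that cutting off at `t` changes
  -- only the exponent.
  have hs : ∀ f g : LTwo k (Ici 0), inner ℂ (expVec g) (T (expVec f)) =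
      inner ℂ (expVec (LTwo.restrict (Ico_sub s) g)) (B (expVec (LTwo.restrict (Ico_sub s) f))) *
        Complex.exp (inner ℂ g f - inner ℂ (LTwo.restrict (Ico_sub s) g)
          (LTwo.restrict (Ico_sub s) f)) := by
    intro f g
    rw [hB]
    nth_rw 1 [← splitMul_expVec_restrict s f, ← splitMul_expVec_restrict s g]
    rw [tensorAt_splitMul, inner_splitMul, one_apply_eq_self, inner_expVec,
      ← inner_restrict_add s g f, add_sub_cancel_left]
  conv_rhs => rw [← splitMul_expVec_restrict t f, ← splitMul_expVec_restrict t g]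
  rw [tensorAt_splitMul, inner_splitMul, one_apply_eq_self, inner_expVec,
    ContinuousLinearMap.comp_apply, ContinuousLinearMap.adjoint_inner_right,
    ContinuousLinearMap.comp_apply, hVe, hVe, hs, hs, restrict_cutoff_of_le h,
    restrict_cutoff_of_le h, mul_assoc, ← Complex.exp_add]
  congr 2
  have h1 : inner ℂ (cutoff t g) (cutoff t f) =
      inner ℂ (LTwo.restrict (Ico_sub t) g) (LTwo.restrict (Ico_sub t) f) :=
    (LTwo.extend measurableSet_Ico (Ico_sub t)).inner_map_map
      (LTwo.restrict (Ico_sub t) g) (LTwo.restrict (Ico_sub t) f)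
  rw [h1, ← inner_restrict_add t g f]
  ring

/-- A `t`-adapted operator acts in the same way on all vectors `ε(f|_{[0,t)}) ⊗ b`. -/
lemma AdaptedAt.inner_splitMul_mul {t : ℝ≥0} {T : FockR k →L[ℂ] FockR k} (hT : AdaptedAt t T)
    (a a' : FockBefore k t) (b b' c c' : FockAfter k t) :
    inner ℂ (splitMul t a b) (T (splitMul t a' b')) * inner ℂ c c' =
      inner ℂ (splitMul t a c) (T (splitMul t a' c')) * inner ℂ b b' := by
  obtain ⟨B, rfl⟩ := hT
  rw [tensorAt_splitMul, tensorAt_splitMul, inner_splitMul, inner_splitMul]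
  simp only [one_apply_eq_self]
  ring

lemma AdaptedAt.norm_splitMul_mul {t : ℝ≥0} {T : FockR k →L[ℂ] FockR k} (hT : AdaptedAt t T)
    (a : FockBefore k t) (b c : FockAfter k t) :
    ‖T (splitMul t a b)‖ * ‖c‖ = ‖T (splitMul t a c)‖ * ‖b‖ := by
  obtain ⟨B, rfl⟩ := hT
  rw [tensorAt_splitMul, tensorAt_splitMul, norm_splitMul, norm_splitMul]
  simp only [one_apply_eq_self]
  ring

/-- The matrix element is `⟨x, y⟩` times a factor depending on `f`, `g`, `T` alone. The
cross-multiplied form survives sums and limits without that factor being named. -/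
lemma AdaptedAt.inner_expShiftL {t : ℝ≥0} {T : FockR k →L[ℂ] FockR k} (hT : AdaptedAt t T)
    (f g : LTwo k (Ici 0)) (x y x' y' : FockR k) :
    inner ℂ (expShiftL f t x) (T (expShiftL g t y)) * inner ℂ x' y' =
      inner ℂ (expShiftL f t x') (T (expShiftL g t y')) * inner ℂ x y := by
  have := hT.inner_splitMul_mul (expVec (LTwo.restrict (Ico_sub t) f))
    (expVec (LTwo.restrict (Ico_sub t) g)) (shiftOpTo t x) (shiftOpTo t y) (shiftOpTo t x')
    (shiftOpTo t y')
  rwa [inner_shiftOpTo, inner_shiftOpTo] at this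

/-- `T` sees only the common factor `ε(f|_{[0,t)})`, so the norms for the right factors `Γ_t x` and
`ε(f|_{[t,∞)})` are proportional, and the latter has norm at least `1`. All convergence estimates
come from this bound. -/
lemma AdaptedAt.norm_expShiftL_le {t : ℝ≥0} {T : FockR k →L[ℂ] FockR k} (hT : AdaptedAt t T)
    (f : LTwo k (Ici 0)) (x : FockR k) : ‖T (expShiftL f t x)‖ ≤ ‖x‖ * ‖T (expVec f)‖ := by
  have h := hT.norm_splitMul_mul (expVec (LTwo.restrict (Ico_sub t) f)) (shiftOpTo t x)
    (expVec (LTwo.restrict (Ici_sub t) f))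
  rw [splitMul_expVec_restrict, norm_shiftOpTo] at h
  rw [expShiftL_apply, mul_comm ‖x‖, ← h]
  exact le_mul_of_one_le_right (norm_nonneg _) (one_le_norm_expVec _)

lemma ccrFlow_coe (s : ℝ≥0) (X : FockR k →L[ℂ] FockR k) :
    ccrFlow s X = tensorAt s 1 (shiftOpTo s ∘L X ∘L ContinuousLinearMap.adjoint (shiftOpTo s)) := by
  rw [ccrFlow, if_neg ENNReal.coe_ne_top]
  rfl

/-- `Γ_s^* Γ_s = I` cancels on the right factor. -/
lemma ccrFlow_expShiftL (s : ℝ≥0) (X : FockR k →L[ℂ] FockR k) (f : LTwo k (Ici 0)) (x : FockR k) :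
    ccrFlow s X (expShiftL f s x) = expShiftL f s (X x) := by
  have h : ContinuousLinearMap.adjoint (shiftOpTo s) (shiftOpTo s x) = x := by
    refine ext_inner_left ℂ fun y => ?_
    rw [ContinuousLinearMap.adjoint_inner_right, inner_shiftOpTo]
  rw [ccrFlow_coe, expShiftL_apply, tensorAt_splitMul, expShiftL_apply]
  simp [h]

lemma norm_ccrFlow_le (s : ℝ≥0∞) (X : FockR k →L[ℂ] FockR k) : ‖ccrFlow s X‖ ≤ max 1 ‖X‖ := by
  induction s with
  | top =>
    rw [ccrFlow, if_pos rfl]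
    exact le_max_of_le_left ContinuousLinearMap.norm_id_le
  | coe s =>
    have h : ‖shiftOpTo (k := k) s‖ ≤ 1 :=
      ContinuousLinearMap.opNorm_le_bound _ zero_le_one fun x => by rw [norm_shiftOpTo, one_mul]
    rw [ccrFlow_coe]
    refine (norm_tensorAt_le _ _ _).trans (le_max_of_le_right ?_)
    have h1 : ‖(1 : FockBefore k s →L[ℂ] FockBefore k s)‖ ≤ 1 := ContinuousLinearMap.norm_id_le
    have h2 : ‖shiftOpTo s ∘L X ∘L ContinuousLinearMap.adjoint (shiftOpTo s)‖ ≤ ‖X‖ := by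
      refine (ContinuousLinearMap.opNorm_comp_le _ _).trans ?_
      have h3 := ContinuousLinearMap.opNorm_comp_le X (ContinuousLinearMap.adjoint (shiftOpTo s))
      rw [LinearIsometryEquiv.norm_map] at h3
      calc _ ≤ 1 * (‖X‖ * 1) := by gcongr; exact h3.trans (by gcongr)
        _ = ‖X‖ := by ring
    calc _ ≤ 1 * ‖X‖ := by gcongr
      _ = ‖X‖ := one_mul _

lemma timeProj_expVec_eq_cutoff (s : ℝ≥0) (f : LTwo k (Ici 0)) :
    timeProj s (expVec f) = expVec (cutoff s f) := by
  rw [timeProj_expVec, expShiftL_expVec, map_zero, add_zero]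

lemma inner_cutoff_right (s : ℝ≥0) (f g : LTwo k (Ici 0)) :
    inner ℂ g (cutoff s f) =
      inner ℂ (LTwo.restrict (Ico_sub s) g) (LTwo.restrict (Ico_sub s) f) := by
  have h := (restrict_extend_add_extend s (LTwo.restrict (Ico_sub s) f) 0).2
  rw [map_zero, add_zero] at h
  rw [← inner_restrict_add s, restrict_cutoff_of_le le_rfl, cutoff, h, inner_zero_right, add_zero]

lemma isStarProjection_timeProj (s : ℝ≥0∞) : IsStarProjection (timeProj (k := k) s) := by
  induction s with
  | top => rw [timeProj_top]; exact IsStarProjection.one (FockR k →L[ℂ] FockR k)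
  | coe s =>
    constructor
    · refine ext_of_total total_expVec fun f => ?_
      rw [mul_apply_eq_comp, timeProj_expVec_eq_cutoff, timeProj_expVec_eq_cutoff]
      conv_lhs => rw [cutoff, restrict_cutoff_of_le le_rfl]
      rfl
    · refine ext_inner_of_total total_expVec total_expVec fun f g => ?_
      rw [ContinuousLinearMap.star_eq_adjoint, ContinuousLinearMap.adjoint_inner_right,
        timeProj_expVec_eq_cutoff, timeProj_expVec_eq_cutoff, inner_expVec, inner_expVec,
        inner_cutoff_right, ← inner_conj_symm (cutoff s g), inner_cutoff_right, inner_conj_symm]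

end Tensor

end StoppedCCR

namespace StoppedCCR

/-! ### Orthogonal projections. -/

section StarProjection

variable {E : Type*} [NormedAddCommGroup E] [InnerProductSpace ℂ E] [CompleteSpace E]
  {P : E →L[ℂ] E}

lemma _root_.IsStarProjection.inner_left (hP : IsStarProjection P) (x y : E) :
    inner ℂ (P x) y = inner ℂ x (P y) := by
  have h : ContinuousLinearMap.adjoint P = P := hP.isSelfAdjoint
  rw [← ContinuousLinearMap.adjoint_inner_right, h]

lemma _root_.IsStarProjection.apply_apply (hP : IsStarProjection P) (x : E) : P (P x) = P x :=
  congrArg (fun T : E →L[ℂ] E => T x) hP.isIdempotentElem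

lemma _root_.IsStarProjection.norm_sq_apply (hP : IsStarProjection P) (x : E) :
    ((‖P x‖ ^ 2 : ℝ) : ℂ) = inner ℂ x (P x) := by
  rw [← hP.apply_apply x, ← hP.inner_left, hP.apply_apply x, inner_self_eq_norm_sq_to_K]
  push_cast
  rfl

lemma _root_.IsStarProjection.norm_apply_le (hP : IsStarProjection P) (x : E) : ‖P x‖ ≤ ‖x‖ := by
  have h1 : ‖P x‖ ^ 2 ≤ ‖x‖ * ‖P x‖ := by
    have h := norm_inner_le_norm (𝕜 := ℂ) x (P x)
    rw [← hP.norm_sq_apply, Complex.norm_real, Real.norm_of_nonneg (by positivity)] at h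
    exact h
  by_contra! h
  nlinarith [norm_nonneg x, norm_nonneg (P x)]

end StarProjection

/-! ### Multiplicativity, orthogonality and adaptedness of the spectral measure. -/

namespace QuantumStopTime

variable {k : Type*} [NormedAddCommGroup k] [InnerProductSpace ℂ k] [CompleteSpace k]
  (S : QuantumStopTime k) {A B : Set ℝ≥0∞}

lemma toFun_union (hA : MeasurableSet A) (hB : MeasurableSet B) (h : Disjoint A B) :
    S.toFun (A ∪ B) = S.toFun A + S.toFun B := by
  ext1 y
  refine ext_inner_left ℂ fun x => ?_
  obtain ⟨μ, hμ⟩ := S.complexMeasure x y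
  rw [add_apply, inner_add_right, ← hμ _ (hA.union hB), ← hμ _ hA, ← hμ _ hB,
    VectorMeasure.of_union h hA hB]

lemma toFun_empty : S.toFun ∅ = 0 := by
  ext1 y
  refine ext_inner_left ℂ fun x => ?_
  obtain ⟨μ, hμ⟩ := S.complexMeasure x y
  rw [← hμ _ MeasurableSet.empty, VectorMeasure.empty, zero_apply, inner_zero_right]

/-- Multiplicativity is not part of the definition. It comes from additivity: `S(A) + S(B)` is again
a projection, so evaluating its quadratic form at `z = S(B) x` gives `‖S(A) z‖² + ‖z‖² ≤ ‖z‖²`. -/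
lemma toFun_apply_eq_zero (hA : MeasurableSet A) (hB : MeasurableSet B) (h : Disjoint A B)
    (x : FockR k) : S.toFun A (S.toFun B x) = 0 := by
  have hAp := S.isStarProjection A hA
  have hBp := S.isStarProjection B hB
  have hU := S.isStarProjection _ (hA.union hB)
  have h1 := hU.norm_apply_le (S.toFun B x)
  have h2 := hU.norm_sq_apply (S.toFun B x)
  rw [S.toFun_union hA hB h, add_apply, inner_add_right, ← hAp.norm_sq_apply,
    ← hBp.norm_sq_apply, hBp.apply_apply] at h2
  have h3 : ‖S.toFun A (S.toFun B x) + S.toFun B x‖ ^ 2 =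
      ‖S.toFun A (S.toFun B x)‖ ^ 2 + ‖S.toFun B x‖ ^ 2 := by exact_mod_cast h2
  rw [S.toFun_union hA hB h, add_apply, hBp.apply_apply] at h1
  have h4 : ‖S.toFun A (S.toFun B x) + S.toFun B x‖ ^ 2 ≤ ‖S.toFun B x‖ ^ 2 := by gcongr
  have h5 : ‖S.toFun A (S.toFun B x)‖ ^ 2 ≤ 0 := by linarith
  simpa using le_antisymm h5 (by positivity)

lemma toFun_apply_toFun (hA : MeasurableSet A) (hB : MeasurableSet B) (x : FockR k) :
    S.toFun A (S.toFun B x) = S.toFun (A ∩ B) x := by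
  have hd : Disjoint (A \ B) B := disjoint_sdiff_self_left
  have hA1 : S.toFun A = S.toFun (A ∩ B) + S.toFun (A \ B) := by
    rw [← S.toFun_union (hA.inter hB) (hA.diff hB)
      (Disjoint.mono_left inter_subset_right hd.symm), inter_union_sdiff]
  have hB1 : S.toFun B = S.toFun (A ∩ B) + S.toFun (B \ A) := by
    rw [inter_comm, ← S.toFun_union (hB.inter hA) (hB.diff hA)
      (Disjoint.mono_left inter_subset_right disjoint_sdiff_self_right), inter_union_sdiff]
  rw [hA1, add_apply, S.toFun_apply_eq_zero (hA.diff hB) hB hd, add_zero, hB1, add_apply, map_add,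
    S.toFun_apply_eq_zero (hA.inter hB) (hB.diff hA)
      (Disjoint.mono_left inter_subset_left disjoint_sdiff_self_right), add_zero,
    (S.isStarProjection _ (hA.inter hB)).apply_apply]

lemma norm_toFun_mono (hA : MeasurableSet A) (hB : MeasurableSet B) (h : A ⊆ B) (x : FockR k) :
    ‖S.toFun A x‖ ≤ ‖S.toFun B x‖ := by
  have := (S.isStarProjection A hA).norm_apply_le (S.toFun B x)
  rwa [S.toFun_apply_toFun hA hB, inter_eq_left.2 h] at this

variable {ι : Type*} {s : Finset ι} {D : ι → Set ℝ≥0∞}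

lemma toFun_biUnion (hD : ∀ i ∈ s, MeasurableSet (D i))
    (hd : (s : Set ι).PairwiseDisjoint D) :
    S.toFun (⋃ i ∈ s, D i) = ∑ i ∈ s, S.toFun (D i) := by
  classical
  induction s using Finset.induction_on with
  | empty => simp [toFun_empty]
  | insert a s ha ih =>
    rw [Finset.set_biUnion_insert, Finset.sum_insert ha,
      ← ih (fun i hi => hD i (Finset.mem_insert_of_mem hi))
        (hd.subset (by simp)), S.toFun_union (hD a (Finset.mem_insert_self _ _))
        (Finset.measurableSet_biUnion _ fun i hi => hD i (Finset.mem_insert_of_mem hi))]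
    rw [Set.disjoint_iUnion₂_right]
    intro i hi
    exact hd (by simp) (by simp [hi]) (fun h => ha (h ▸ hi))

lemma inner_toFun_apply_eq_zero (hA : MeasurableSet A) (hB : MeasurableSet B) (h : Disjoint A B)
    (x y : FockR k) : inner ℂ (S.toFun A x) (S.toFun B y) = 0 := by
  rw [(S.isStarProjection A hA).inner_left, S.toFun_apply_eq_zero hA hB h, inner_zero_right]

lemma inner_sum_toFun (hD : ∀ i ∈ s, MeasurableSet (D i)) (hd : (s : Set ι).PairwiseDisjoint D)
    (v w : ι → FockR k) :
    inner ℂ (∑ i ∈ s, S.toFun (D i) (v i)) (∑ i ∈ s, S.toFun (D i) (w i)) =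
      ∑ i ∈ s, inner ℂ (v i) (S.toFun (D i) (w i)) := by
  rw [sum_inner]
  refine Finset.sum_congr rfl fun i hi => ?_
  rw [inner_sum, Finset.sum_eq_single_of_mem i hi fun j hj hji =>
    S.inner_toFun_apply_eq_zero (hD i hi) (hD j hj) (hd hi hj hji.symm) _ _,
    (S.isStarProjection _ (hD i hi)).inner_left, (S.isStarProjection _ (hD i hi)).apply_apply]

lemma norm_sq_sum_toFun (hD : ∀ i ∈ s, MeasurableSet (D i))
    (hd : (s : Set ι).PairwiseDisjoint D) (v : ι → FockR k) :
    ‖∑ i ∈ s, S.toFun (D i) (v i)‖ ^ 2 = ∑ i ∈ s, ‖S.toFun (D i) (v i)‖ ^ 2 := by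
  have h := S.inner_sum_toFun hD hd v v
  rw [inner_self_eq_norm_sq_to_K] at h
  apply Complex.ofReal_injective
  push_cast
  refine h.trans (Finset.sum_congr rfl fun i hi => ?_)
  rw [← (S.isStarProjection _ (hD i hi)).norm_sq_apply]
  push_cast
  rfl

/-- A Bessel inequality: the pieces `S(D i) x` are orthogonal and add up to the projection of a
subset of `B`. -/
lemma sum_norm_sq_toFun_le (hD : ∀ i ∈ s, MeasurableSet (D i))
    (hd : (s : Set ι).PairwiseDisjoint D) (hB : MeasurableSet B) (hDB : ∀ i ∈ s, D i ⊆ B)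
    (x : FockR k) :
    ∑ i ∈ s, ‖S.toFun (D i) x‖ ^ 2 ≤ ‖S.toFun B x‖ ^ 2 := by
  rw [← S.norm_sq_sum_toFun hD hd, ← sum_apply, ← S.toFun_biUnion hD hd]
  have := S.norm_toFun_mono (Finset.measurableSet_biUnion _ hD) hB (iUnion₂_subset hDB) x
  gcongr

/-- Continuity from above of the measure `⟨x, S(·) x⟩`, as the sets `(n,∞]` decrease to `{∞}`.
Finiteness of `S` enters the analysis here. -/
lemma tendsto_toFun_Ioc_top (hfinite : S.toFun {∞} = 0) (x : FockR k) :
    Tendsto (fun n : ℕ => S.toFun (Ioc (n : ℝ≥0∞) ∞) x) atTop (𝓝 0) := by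
  obtain ⟨μ, hμ⟩ := S.complexMeasure x x
  have h1 := VectorMeasure.tendsto_vectorMeasure_iInter_atTop_nat (v := μ)
    (s := fun n : ℕ => Ioc (n : ℝ≥0∞) ∞)
    (fun m n h => Ioc_subset_Ioc_left (by exact_mod_cast h)) (fun n => measurableSet_Ioc)
  have h2 : (⋂ n : ℕ, Ioc (n : ℝ≥0∞) ∞) = {∞} := by
    ext t
    simp only [mem_iInter, mem_Ioc, le_top, and_true, mem_singleton_iff]
    refine ⟨fun h => ?_, fun h n => h ▸ ENNReal.natCast_lt_top n⟩
    by_contra ht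
    obtain ⟨n, hn⟩ := ENNReal.exists_nat_gt ht
    exact absurd (h n) (not_lt.2 hn.le)
  rw [h2, hμ _ (measurableSet_singleton _), hfinite, zero_apply, inner_zero_right] at h1
  have h3 : Tendsto (fun n : ℕ => ‖S.toFun (Ioc (n : ℝ≥0∞) ∞) x‖ ^ 2) atTop (𝓝 0) := by
    have h4 := (Complex.continuous_re.tendsto _).comp h1
    refine h4.congr fun n => ?_
    rw [Function.comp, hμ _ measurableSet_Ioc,
      ← (S.isStarProjection _ measurableSet_Ioc).norm_sq_apply, Complex.ofReal_re]
  rw [tendsto_zero_iff_norm_tendsto_zero]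
  simpa using h3.sqrt

variable {S}

lemma toFun_Ioc_eq_sub {a b : ℝ≥0∞} (h : a ≤ b) :
    S.toFun (Ioc a b) = S.toFun (Icc 0 b) - S.toFun (Icc 0 a) := by
  rw [eq_sub_iff_add_eq, add_comm, ← S.toFun_union measurableSet_Icc measurableSet_Ioc,
    Icc_union_Ioc_eq_Icc (zero_le) h]
  exact Set.disjoint_left.2 fun s hs hs' => absurd hs'.1 (not_lt.2 hs.2)

lemma adaptedAt_Icc (hzero : S.toFun {0} = 0) {b t : ℝ≥0} (h : b ≤ t) :
    AdaptedAt t (S.toFun (Icc 0 (b : ℝ≥0∞))) := by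
  -- Adaptedness is given only at positive times; at `b = 0` the assumption `S({0}) = 0` replaces
  -- it.
  rcases eq_or_lt_of_le (zero_le (a := b)) with h0 | h0
  · rw [← h0, ENNReal.coe_zero, Icc_self, hzero]
    exact adaptedAt_zero t
  · exact AdaptedAt.mono h (S.adapted b h0)

lemma adaptedAt_Ioc (hzero : S.toFun {0} = 0) (a : ℝ≥0∞) {b t : ℝ≥0} (h : b ≤ t) :
    AdaptedAt t (S.toFun (Ioc a (b : ℝ≥0∞))) := by
  rcases le_or_gt a (b : ℝ≥0∞) with hab | hab
  · lift a to ℝ≥0 using ne_top_of_le_ne_top ENNReal.coe_ne_top hab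
    rw [toFun_Ioc_eq_sub hab]
    exact (adaptedAt_Icc hzero h).sub (adaptedAt_Icc hzero ((ENNReal.coe_le_coe.1 hab).trans h))
  · rw [Ioc_eq_empty (not_lt.2 hab.le), S.toFun_empty]
    exact adaptedAt_zero t

end QuantumStopTime

end StoppedCCR

namespace StoppedCCR

/-! ### Combinatorics of partitions. -/

namespace TimePartition

variable {t : ℝ≥0∞} (π : TimePartition t)

/-- The least point of the partition that is not less than `s`. -/
def ceil (s : ℝ≥0∞) : ℝ≥0∞ := (π.1.filter (s ≤ ·)).inf id

lemma le_ceil (s : ℝ≥0∞) : s ≤ ceil π s :=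
  Finset.le_inf fun _ hp => (Finset.mem_filter.1 hp).2

variable {π}

lemma ceil_le {s p : ℝ≥0∞} (hp : p ∈ π.1) (h : s ≤ p) : ceil π s ≤ p :=
  Finset.inf_le (f := id) (Finset.mem_filter.2 ⟨hp, h⟩)

lemma ceil_mem {s : ℝ≥0∞} (hs : s ≤ t) : ceil π s ∈ π.1 := by
  obtain ⟨p, hp, h⟩ := Finset.exists_mem_eq_inf (π.1.filter (s ≤ ·))
    ⟨t, Finset.mem_filter.2 ⟨π.2.2.1, hs⟩⟩ id
  rw [ceil, h]
  exact (Finset.mem_filter.1 hp).1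

/-- The cells of a partition are the fibres of `ceil` over `(0,t]`. Disjointness, covering and
behaviour under refinement all follow from this. -/
lemma mem_Ioc_pred_iff {s p : ℝ≥0∞} (hp : p ∈ π.1) :
    s ∈ Ioc (π.pred p) p ↔ 0 < s ∧ s ≤ t ∧ ceil π s = p := by
  constructor
  · rintro ⟨h1, h2⟩
    refine ⟨lt_of_le_of_lt (zero_le) h1, h2.trans (π.2.2.2 p hp), le_antisymm (ceil_le hp h2) ?_⟩
    by_contra! h3
    have h4 : ceil π s ≤ π.pred p := Finset.le_sup (f := id)
      (Finset.mem_filter.2 ⟨ceil_mem (h2.trans (π.2.2.2 p hp)), h3⟩)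
    exact absurd (h1.trans_le (le_ceil π s)) (not_lt.2 h4)
  · rintro ⟨h0, ht, rfl⟩
    refine ⟨(Finset.sup_lt_iff (by simpa using h0)).2 fun q hq => ?_, le_ceil π s⟩
    obtain ⟨hq1, hq2⟩ := Finset.mem_filter.1 hq
    by_contra! h
    exact absurd hq2 (not_lt.2 (ceil_le hq1 h))

variable (π) in
lemma pairwiseDisjoint_Ioc_pred :
    (↑(π.1.erase 0) : Set ℝ≥0∞).PairwiseDisjoint fun p => Ioc (π.pred p) p := by
  intro p hp q hq hpq
  refine Set.disjoint_left.2 fun s hs hs' => hpq ?_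
  have h1 := (mem_Ioc_pred_iff (Finset.mem_of_mem_erase hp)).1 hs
  have h2 := (mem_Ioc_pred_iff (Finset.mem_of_mem_erase hq)).1 hs'
  rw [← h1.2.2, h2.2.2]

variable (π) in
lemma biUnion_Ioc_pred : (⋃ p ∈ π.1.erase 0, Ioc (π.pred p) p) = Ioc 0 t := by
  ext s
  simp only [mem_iUnion, exists_prop]
  constructor
  · rintro ⟨p, hp, hs⟩
    have h := (mem_Ioc_pred_iff (Finset.mem_of_mem_erase hp)).1 hs
    exact ⟨h.1, h.2.1⟩
  · rintro ⟨h0, ht⟩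
    refine ⟨ceil π s, Finset.mem_erase.2 ⟨(h0.trans_le (le_ceil π s)).ne', ceil_mem ht⟩, ?_⟩
    exact (mem_Ioc_pred_iff (ceil_mem ht)).2 ⟨h0, ht, rfl⟩

variable {π' : TimePartition t}

lemma ceil_ceil (h : π ≤ π') {s : ℝ≥0∞} (hs : s ≤ t) : ceil π (ceil π' s) = ceil π s :=
  le_antisymm (ceil_le (ceil_mem hs) (ceil_le (h (ceil_mem hs)) (le_ceil π s)))
    (ceil_le (ceil_mem (π'.2.2.2 _ (ceil_mem hs))) ((le_ceil π' s).trans (le_ceil π _)))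

lemma Ioc_pred_eq_biUnion (h : π ≤ π') {p : ℝ≥0∞} (hp : p ∈ π.1) :
    Ioc (π.pred p) p = ⋃ q ∈ (π'.1.erase 0).filter (ceil π · = p), Ioc (π'.pred q) q := by
  ext s
  rw [mem_Ioc_pred_iff hp]
  simp only [mem_iUnion, exists_prop, Finset.mem_filter]
  constructor
  · rintro ⟨h0, ht, rfl⟩
    refine ⟨ceil π' s, ⟨Finset.mem_erase.2 ⟨(h0.trans_le (le_ceil π' s)).ne', ceil_mem ht⟩,
      ceil_ceil h ht⟩, (mem_Ioc_pred_iff (ceil_mem ht)).2 ⟨h0, ht, rfl⟩⟩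
  · rintro ⟨q, ⟨hq, rfl⟩, hs⟩
    obtain ⟨h0, ht, rfl⟩ := (mem_Ioc_pred_iff (Finset.mem_of_mem_erase hq)).1 hs
    exact ⟨h0, ht, (ceil_ceil h ht).symm⟩

lemma le_pred {p q : ℝ≥0∞} (hq : q ∈ π.1) (h : q < p) : q ≤ π.pred p :=
  Finset.le_sup (f := id) (Finset.mem_filter.2 ⟨hq, h⟩)

lemma exists_mesh (n : ℕ) {δ : ℝ≥0} (hδ : 0 < δ) : ∃ π : TimePartition ∞, (n : ℝ≥0∞) ∈ π.1 ∧
    ∀ q : ℝ≥0, q ≤ n → ∃ p : ℝ≥0, ceil π q = p ∧ q ≤ p ∧ p ≤ n ∧ p ≤ q + δ := by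
  obtain ⟨N, hN⟩ := exists_nat_gt (1 / δ)
  have hN0 : (0 : ℝ≥0) < N := lt_of_le_of_lt (zero_le) hN
  have hNδ : 1 / (N : ℝ≥0) ≤ δ := by
    rw [div_le_iff₀ hN0, mul_comm, ← div_le_iff₀ hδ]
    exact hN.le
  -- The grid of mesh `1/N ≤ δ` on `[0,n]`, both endpoints included, together with `∞`.
  let P : Finset ℝ≥0∞ := insert ∞ ((Finset.range (n * N + 1)).image
    fun j : ℕ => (((j : ℝ≥0) / N : ℝ≥0) : ℝ≥0∞))
  have hP : ∀ j : ℕ, j ≤ n * N → (((j : ℝ≥0) / N : ℝ≥0) : ℝ≥0∞) ∈ P := fun j hj =>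
    Finset.mem_insert_of_mem (Finset.mem_image.2 ⟨j, Finset.mem_range.2 (by omega), rfl⟩)
  refine ⟨⟨P, by simpa using hP 0 (Nat.zero_le _), Finset.mem_insert_self _ _, fun _ _ => le_top⟩,
    ?_, fun q hq => ?_⟩
  · have := hP (n * N) le_rfl
    rw [Nat.cast_mul, mul_div_cancel_right₀ _ hN0.ne'] at this
    exact this
  · have hj : ⌈q * N⌉₊ ≤ n * N := Nat.ceil_le.2 (by push_cast; gcongr)
    have h1 : q ≤ (⌈q * N⌉₊ : ℝ≥0) / N := by
      rw [le_div_iff₀ hN0]; exact Nat.le_ceil _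
    have h2 : (⌈q * N⌉₊ : ℝ≥0) / N ≤ q + 1 / N := by
      rw [div_le_iff₀ hN0, add_mul, one_div_mul_cancel hN0.ne']
      exact (Nat.ceil_lt_add_one (zero_le)).le
    have h3 : (⌈q * N⌉₊ : ℝ≥0) / N ≤ n := by
      rw [div_le_iff₀ hN0]; exact_mod_cast hj
    have h4 := ceil_le (π := ⟨P, by simpa using hP 0 (Nat.zero_le _), Finset.mem_insert_self _ _,
      fun _ _ => le_top⟩) (hP _ hj) (ENNReal.coe_le_coe.2 h1)
    -- `ceil` of `q` is at most the grid point `⌈q N⌉ / N`, hence finite; that grid point also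
    -- bounds its distance from `q`.
    have hp := (ENNReal.coe_toNNReal (ne_top_of_le_ne_top ENNReal.coe_ne_top h4))
    generalize ENNReal.toNNReal _ = p at hp
    rw [← hp, ENNReal.coe_le_coe] at h4
    refine ⟨p, hp.symm, ?_, h4.trans h3, h4.trans (h2.trans (by gcongr))⟩
    rw [← ENNReal.coe_le_coe, hp]
    exact le_ceil _ _

end TimePartition

/-! ### Estimates and limits of partition sums. -/

namespace QuantumStopTime

open TimePartition

variable {k : Type*} [NormedAddCommGroup k] [InnerProductSpace ℂ k] [CompleteSpace k]
  {S : QuantumStopTime k}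

/-- Puts the sum over `π` on the cells of the refinement, so that the difference of the two sums is
one sum with integrand `v(ceil π q) - v(q)`. -/
lemma sum_increment_refine {t : ℝ≥0∞} {π π' : TimePartition t} (h : π ≤ π')
    (v : ℝ≥0∞ → FockR k) :
    ∑ p ∈ π.1.erase 0, S.increment π p (v p) =
      ∑ q ∈ π'.1.erase 0, S.increment π' q (v (ceil π q)) := by
  have hmaps : ∀ q ∈ π'.1.erase 0, ceil π q ∈ π.1.erase 0 := by
    intro q hq
    obtain ⟨h0, hq⟩ := Finset.mem_erase.1 hq
    exact Finset.mem_erase.2 ⟨((pos_iff_ne_zero.2 h0).trans_le (le_ceil π q)).ne',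
      ceil_mem (π'.2.2.2 q hq)⟩
  rw [← Finset.sum_fiberwise_of_maps_to hmaps]
  refine Finset.sum_congr rfl fun p hp => ?_
  rw [increment, Ioc_pred_eq_biUnion h (Finset.mem_of_mem_erase hp), toFun_biUnion
    (hD := fun _ _ => measurableSet_Ioc) (hd := (pairwiseDisjoint_Ioc_pred π').subset
      (Finset.coe_subset.2 (Finset.filter_subset _ _))), sum_apply]
  refine Finset.sum_congr rfl fun q hq => ?_
  rw [(Finset.mem_filter.1 hq).2, increment]

lemma norm_sq_sum_increment {t : ℝ≥0∞} (π : TimePartition t) (v : ℝ≥0∞ → FockR k) :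
    ‖∑ p ∈ π.1.erase 0, S.increment π p (v p)‖ ^ 2 =
      ∑ p ∈ π.1.erase 0, ‖S.increment π p (v p)‖ ^ 2 :=
  S.norm_sq_sum_toFun (fun _ _ => measurableSet_Ioc) (pairwiseDisjoint_Ioc_pred π) v

lemma sum_norm_sq_increment_le {t : ℝ≥0∞} (π : TimePartition t) (x : FockR k) :
    ∑ p ∈ π.1.erase 0, ‖S.increment π p x‖ ^ 2 ≤ ‖x‖ ^ 2 := by
  have h := S.sum_norm_sq_toFun_le (fun _ _ => measurableSet_Ioc) (pairwiseDisjoint_Ioc_pred π)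
    MeasurableSet.univ (fun _ _ => subset_univ _) x
  refine h.trans ?_
  rw [S.map_univ, one_apply_eq_self]

/-- Partition sums of an integrand that is small near the diagonal are small. -/
lemma exists_partition_norm_sum_le (hfinite : S.toFun {∞} = 0) {d : ℝ≥0∞ → ℝ≥0∞ → FockR k}
    {e z : FockR k} {C : ℝ} (hC : 0 ≤ C)
    (h1 : ∀ η > 0, ∀ n : ℕ, ∃ δ > (0 : ℝ≥0), ∀ p q : ℝ≥0, q ≤ p → p ≤ n → p ≤ q + δ →
      ∀ a, ‖S.toFun (Ioc a q) (d p q)‖ ≤ η * ‖S.toFun (Ioc a q) e‖)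
    (h2 : ∀ p q, q ≤ p → ∀ a, ‖S.toFun (Ioc a q) (d p q)‖ ^ 2 ≤
      C * (‖S.toFun (Ioc a q) e‖ ^ 2 + ‖S.toFun (Ioc a q) z‖ ^ 2)) {ε : ℝ} (hε : 0 < ε) :
    ∃ π : TimePartition ∞, ∀ π' : TimePartition ∞, π ≤ π' →
      ‖∑ q ∈ π'.1.erase 0, S.increment π' q (d (ceil π q) q)‖ ≤ ε := by
  have ht : Tendsto (fun n : ℕ => C * (‖S.toFun (Ioc (n : ℝ≥0∞) ∞) e‖ ^ 2 +
      ‖S.toFun (Ioc (n : ℝ≥0∞) ∞) z‖ ^ 2)) atTop (𝓝 0) := by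
    have a1 := (S.tendsto_toFun_Ioc_top hfinite e).norm.pow 2
    have a2 := (S.tendsto_toFun_Ioc_top hfinite z).norm.pow 2
    simpa using (a1.add a2).const_mul C
  obtain ⟨n, hn⟩ := (ht.eventually (gt_mem_nhds (show (0 : ℝ) < ε ^ 2 / 2 by positivity))).exists
  -- Ensures `η ‖e‖ ≤ ε/2`; with the bound `ε²/2` for the tail, the total is at most `ε²/4 + ε²/2 ≤
  -- ε²`.
  set η : ℝ := ε / (2 * (‖e‖ + 1)) with hη
  have hη0 : 0 < η := by positivity
  obtain ⟨δ, hδ0, hδ⟩ := h1 η hη0 n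
  obtain ⟨π, hnπ, hπ⟩ := exists_mesh n hδ0
  refine ⟨π, fun π' hππ' => ?_⟩
  set A : Set ℝ≥0∞ := Ioc (n : ℝ≥0∞) ∞
  have key : ∀ q ∈ π'.1.erase 0, ‖S.increment π' q (d (ceil π q) q)‖ ^ 2 ≤
      η ^ 2 * ‖S.increment π' q e‖ ^ 2 + C * (‖S.toFun (Ioc (π'.pred q) q ∩ A) e‖ ^ 2 +
        ‖S.toFun (Ioc (π'.pred q) q ∩ A) z‖ ^ 2) := by
    intro q hq
    rcases le_or_gt q n with hqn | hqn
    · lift q to ℝ≥0 using ne_top_of_le_ne_top (ENNReal.natCast_ne_top n) hqn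
      have hqn' : q ≤ n := by exact_mod_cast hqn
      obtain ⟨p, hp, b1, b2, b3⟩ := hπ q hqn'
      rw [hp]
      have b4 := hδ p q b1 b2 b3 (π'.pred q)
      have b5 : ‖S.increment π' q (d p q)‖ ^ 2 ≤ (η * ‖S.increment π' q e‖) ^ 2 := by
        have b6 : ‖S.increment π' q (d p q)‖ ≤ η * ‖S.increment π' q e‖ := b4
        gcongr
      rw [mul_pow] at b5
      have b7 : 0 ≤ C * (‖S.toFun (Ioc (π'.pred q) q ∩ A) e‖ ^ 2 +
        ‖S.toFun (Ioc (π'.pred q) q ∩ A) z‖ ^ 2) := by positivity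
      linarith
    -- As `n` belongs to `π'`, no cell straddles it: a cell ending after `n` lies wholly in `(n,∞]`.
    · have b1 : Ioc (π'.pred q) q ∩ A = Ioc (π'.pred q) q := inter_eq_left.2 fun s hs =>
        ⟨lt_of_le_of_lt (le_pred (hππ' hnπ) hqn) hs.1, le_top⟩
      rw [b1]
      have b2 := h2 (ceil π q) q (le_ceil π q) (π'.pred q)
      have b3 : 0 ≤ η ^ 2 * ‖S.increment π' q e‖ ^ 2 := by positivity
      exact b2.trans (by linarith)
  have hsum : ∀ x : FockR k, ∑ q ∈ π'.1.erase 0, ‖S.toFun (Ioc (π'.pred q) q ∩ A) x‖ ^ 2 ≤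
      ‖S.toFun A x‖ ^ 2 := fun x =>
    S.sum_norm_sq_toFun_le (fun _ _ => measurableSet_Ioc.inter measurableSet_Ioc)
      ((pairwiseDisjoint_Ioc_pred π').mono fun _ => inter_subset_left) measurableSet_Ioc
      (fun _ _ => inter_subset_right) x
  have hfin : ‖∑ q ∈ π'.1.erase 0, S.increment π' q (d (ceil π q) q)‖ ^ 2 ≤ ε ^ 2 := by
    rw [norm_sq_sum_increment]
    refine (Finset.sum_le_sum key).trans ?_
    rw [Finset.sum_add_distrib, ← Finset.mul_sum, ← Finset.mul_sum, Finset.sum_add_distrib]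
    have c1 : η ^ 2 * ∑ q ∈ π'.1.erase 0, ‖S.increment π' q e‖ ^ 2 ≤ η ^ 2 * ‖e‖ ^ 2 := by
      gcongr; exact sum_norm_sq_increment_le π' e
    have c2 : η * ‖e‖ ≤ ε / 2 := by
      rw [hη, div_mul_eq_mul_div, div_le_div_iff₀ (by positivity) two_pos]
      nlinarith [norm_nonneg e]
    have c3 : η ^ 2 * ‖e‖ ^ 2 ≤ (ε / 2) ^ 2 := by
      rw [← mul_pow]; gcongr
    have c4 : C * (∑ q ∈ π'.1.erase 0, ‖S.toFun (Ioc (π'.pred q) q ∩ A) e‖ ^ 2 +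
        ∑ q ∈ π'.1.erase 0, ‖S.toFun (Ioc (π'.pred q) q ∩ A) z‖ ^ 2) ≤
        C * (‖S.toFun A e‖ ^ 2 + ‖S.toFun A z‖ ^ 2) := by
      gcongr
      · exact hsum e
      · exact hsum z
    nlinarith [sq_nonneg ε]
  exact le_of_sq_le_sq hfin hε.le

/-- The last cell lies in `(n,∞]` once the partition contains `n`. Consequently the value of an
integrand at `∞` does not affect its integral. -/
lemma tendsto_increment_top (hfinite : S.toFun {∞} = 0) (z : FockR k) :
    Tendsto (fun π : TimePartition ∞ => S.increment π ∞ z) atTop (𝓝 0) := by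
  rw [Metric.tendsto_nhds]
  intro ε hε
  obtain ⟨n, hn⟩ := ((Metric.tendsto_nhds.1 (S.tendsto_toFun_Ioc_top hfinite z)) ε hε).exists
  let π₀ : TimePartition ∞ := ⟨{0, (n : ℝ≥0∞), ∞}, by simp, by simp, fun _ _ => le_top⟩
  filter_upwards [eventually_ge_atTop π₀] with π hπ
  rw [dist_zero_right] at *
  refine lt_of_le_of_lt (S.norm_toFun_mono measurableSet_Ioc measurableSet_Ioc
    (Ioc_subset_Ioc_left (le_pred (hπ ?_) (ENNReal.natCast_lt_top n))) z) hn
  simp [π₀]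

lemma HasStopIntegral.congr (hfinite : S.toFun {∞} = 0) {v w : ℝ≥0∞ → FockR k} {y : FockR k}
    (h : S.HasStopIntegral ∞ v y) (hvw : ∀ s : ℝ≥0, v s = w s) : S.HasStopIntegral ∞ w y := by
  have h1 := h.add (tendsto_increment_top hfinite (w ∞ - v ∞))
  rw [add_zero] at h1
  refine h1.congr fun π => ?_
  have hm : ∞ ∈ π.1.erase 0 := Finset.mem_erase.2 ⟨ENNReal.top_ne_zero, π.2.2.1⟩
  rw [← Finset.add_sum_erase _ _ hm, ← Finset.add_sum_erase (π.1.erase 0) _ hm, map_sub]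
  have h2 : ∑ p ∈ (π.1.erase 0).erase ∞, S.increment π p (v p) =
      ∑ p ∈ (π.1.erase 0).erase ∞, S.increment π p (w p) := by
    refine Finset.sum_congr rfl fun p hp => ?_
    lift p to ℝ≥0 using Finset.ne_of_mem_erase hp
    rw [hvw]
  rw [h2]
  abel

/-- Restriction of a stop-time integral over `[0, ∞]` to `[0, t]`. -/
lemma HasStopIntegral.restrict {v : ℝ≥0∞ → FockR k} {y : FockR k}
    (h : S.HasStopIntegral ∞ v y) (t : ℝ≥0∞) :
    S.HasStopIntegral t v (S.toFun (Icc 0 t) y) := by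
  have h1 : Tendsto (fun π : TimePartition ∞ => S.toFun (Icc 0 t)
      (∑ p ∈ π.1.erase 0, S.increment π p (v p))) atTop (𝓝 (S.toFun (Icc 0 t) y)) :=
    ((S.toFun (Icc 0 t)).continuous.tendsto y).comp h
  rw [HasStopIntegral, Metric.tendsto_nhds]
  intro ε hε
  obtain ⟨π₀, hπ₀⟩ := (eventually_atTop.1 (Metric.tendsto_nhds.1 h1 ε hε))
  -- The trace of `π₀` on `[0,t]`. A partition `π` finer than `ρ`, joined with `π₀`, has the same
  -- cells as `π` inside `[0,t]`, and `S([0,t])` annihilates the others.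
  let ρ : TimePartition t := ⟨(insert t π₀.1).filter (· ≤ t),
    Finset.mem_filter.2 ⟨Finset.mem_insert_of_mem π₀.2.1, zero_le⟩,
    Finset.mem_filter.2 ⟨Finset.mem_insert_self _ _, le_rfl⟩,
    fun p hp => (Finset.mem_filter.1 hp).2⟩
  filter_upwards [eventually_ge_atTop ρ] with π hπ
  let π' : TimePartition ∞ := ⟨π.1 ∪ π₀.1, Finset.mem_union_left _ π.2.1,
    Finset.mem_union_right _ π₀.2.2.1, fun _ _ => le_top⟩
  have hmem : ∀ p, p ∈ π'.1 → p ≤ t → p ∈ π.1 := by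
    intro p hp hpt
    rcases Finset.mem_union.1 hp with hp | hp
    · exact hp
    · exact hπ (Finset.mem_filter.2 ⟨Finset.mem_insert_of_mem hp, hpt⟩)
  have hsub : π.1 ⊆ π'.1 := Finset.subset_union_left
  have hpred : ∀ p ≤ t, π'.pred p = π.pred p := by
    intro p hp
    unfold TimePartition.pred
    congr 1
    ext q
    simp only [Finset.mem_filter]
    exact ⟨fun hq => ⟨hmem q hq.1 (hq.2.le.trans hp), hq.2⟩, fun hq => ⟨hsub hq.1, hq.2⟩⟩
  have heq : S.toFun (Icc 0 t) (∑ p ∈ π'.1.erase 0, S.increment π' p (v p)) =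
      ∑ p ∈ π.1.erase 0, S.increment π p (v p) := by
    rw [map_sum]
    symm
    refine Finset.sum_subset_zero_on_sdiff (Finset.erase_subset_erase _ hsub) (fun p hp => ?_)
      (fun p hp => ?_)
    · obtain ⟨hp, hp'⟩ := Finset.mem_sdiff.1 hp
      obtain ⟨hp0, hp⟩ := Finset.mem_erase.1 hp
      have hpt : t < p := by
        by_contra! hpt
        exact hp' (Finset.mem_erase.2 ⟨hp0, hmem p hp hpt⟩)
      refine S.toFun_apply_eq_zero measurableSet_Icc measurableSet_Ioc
        (Set.disjoint_left.2 fun s hs hs' => ?_) _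
      exact absurd (lt_of_le_of_lt (le_pred (hsub π.2.2.1) hpt) hs'.1) (not_lt.2 hs.2)
    · have hpt := π.2.2.2 p (Finset.mem_of_mem_erase hp)
      rw [increment, increment, hpred p hpt, S.toFun_apply_toFun measurableSet_Icc
        measurableSet_Ioc, inter_eq_right.2]
      exact fun s hs => ⟨zero_le, hs.2.trans hpt⟩
  have := hπ₀ π' Finset.subset_union_right
  rwa [heq] at this

end QuantumStopTime

end StoppedCCR

namespace StoppedCCR

/-! ### The decreasing subspaces `ε(f|_{[0,q)}) ⊗ F_{[q}`. -/

section

variable {k : Type*} [NormedAddCommGroup k] [InnerProductSpace ℂ k]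

lemma norm_le_norm_expShiftL (f : LTwo k (Ici 0)) (s : ℝ≥0) (x : FockR k) :
    ‖x‖ ≤ ‖expShiftL f s x‖ := by
  rw [expShiftL_apply, norm_splitMul, norm_shiftOpTo]
  exact le_mul_of_one_le_left (norm_nonneg _) (one_le_norm_expVec _)

lemma continuous_expShiftL_comp (f : LTwo k (Ici 0)) {X : Type*} [TopologicalSpace X]
    {s : X → ℝ≥0} {y : X → FockR k} (hy : Continuous y) (hs : Continuous s := by fun_prop) :
    Continuous fun u => expShiftL f (s u) (y u) :=
  Continuous.comp (g := fun p : ℝ≥0 × FockR k => expShiftL f p.1 p.2) (f := fun u => (s u, y u))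
    (continuous_expShiftL f) (hs.prodMk hy)

/-- The operator is bounded below. Closedness allows membership in the range to be checked on
exponential vectors. -/
lemma isClosed_range_expShiftL (f : LTwo k (Ici 0)) (s : ℝ≥0) :
    IsClosed (LinearMap.range (expShiftL f s).toLinearMap : Set (FockR k)) := by
  have h : AntilipschitzWith 1 (expShiftL f s) :=
    (expShiftL f s).antilipschitz_of_bound fun x => by
      simpa using norm_le_norm_expShiftL f s x
  exact h.isClosed_range (expShiftL f s).uniformContinuous

lemma expVec_mem_range_expShiftL (f : LTwo k (Ici 0)) (s : ℝ≥0) :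
    expVec f ∈ LinearMap.range (expShiftL f s).toLinearMap :=
  ⟨_, expShiftL_leftShift f s⟩

lemma cutoff_cutoff_add_rightShift {q p : ℝ≥0} (h : q ≤ p) (f g : LTwo k (Ici 0)) :
    cutoff q (cutoff p f + rightShift p g) = cutoff q f := by
  have h1 : LTwo.restrict (Ico_sub p) (cutoff p f + rightShift p g) =
      LTwo.restrict (Ico_sub p) f :=
    (restrict_extend_add_extend p (LTwo.restrict (Ico_sub p) f) (shiftTo p g)).1
  rw [cutoff, ← restrict_cutoff_of_le h, cutoff, h1]
  change LTwo.extend _ _ (LTwo.restrict _ (cutoff p f)) = _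
  rw [restrict_cutoff_of_le h]
  rfl

/-- For exponential `x` the vector is `ε(h)` with `h = f` on `[0,q)`, hence `ε(f|_{[0,q)}) ⊗ Γ_q
ε(θ_q^* h)`. This brings differences of values at times `p ≥ q` within reach of the estimate for
operators adapted at `q`. -/
lemma range_expShiftL_antitone {q p : ℝ≥0} (h : q ≤ p) (f : LTwo k (Ici 0)) (x : FockR k) :
    expShiftL f p x ∈ LinearMap.range (expShiftL f q).toLinearMap := by
  refine mem_of_total total_expVec
    ((LinearMap.range (expShiftL f q).toLinearMap).comap (expShiftL f p).toLinearMap)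
    ((isClosed_range_expShiftL f q).preimage (expShiftL f p).continuous) (fun g => ?_) x
  change expShiftL f p (expVec g) ∈ LinearMap.range (expShiftL f q).toLinearMap
  rw [expShiftL_expVec]
  refine ⟨expVec (leftShift q (cutoff p f + rightShift p g)), ?_⟩
  change expShiftL f q _ = _
  rw [expShiftL_expVec]
  conv_rhs => rw [← cutoff_add_rightShift q (cutoff p f + rightShift p g),
    cutoff_cutoff_add_rightShift h]

variable [CompleteSpace k]

lemma AdaptedAt.norm_le_of_mem_range {t : ℝ≥0} {T : FockR k →L[ℂ] FockR k} (hT : AdaptedAt t T)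
    {f : LTwo k (Ici 0)} {w : FockR k} (hw : w ∈ LinearMap.range (expShiftL f t).toLinearMap) :
    ‖T w‖ ≤ ‖w‖ * ‖T (expVec f)‖ := by
  obtain ⟨x, rfl⟩ := hw
  refine (hT.norm_expShiftL_le f x).trans ?_
  gcongr
  exact norm_le_norm_expShiftL f t x

end

lemma exists_uniform_near_diagonal {E : Type*} [NormedAddCommGroup E] {D : ℝ≥0 × ℝ≥0 → E}
    (hD : Continuous D) (h0 : ∀ q, D (q, q) = 0) {η : ℝ} (hη : 0 < η) (n : ℝ≥0) :
    ∃ δ > (0 : ℝ≥0), ∀ p q : ℝ≥0, q ≤ p → p ≤ n → p ≤ q + δ → ‖D (p, q)‖ ≤ η := by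
  have hc : IsCompact (Icc (0 : ℝ≥0) n ×ˢ Icc (0 : ℝ≥0) n) := isCompact_Icc.prod isCompact_Icc
  have hu := hc.uniformContinuousOn_of_continuous hD.continuousOn
  obtain ⟨δ, hδ, h⟩ := Metric.uniformContinuousOn_iff.1 hu η hη
  refine ⟨(δ / 2).toNNReal, by simpa using hδ, fun p q hqp hpn hpq => ?_⟩
  have h1 : dist (p, q) (q, q) < δ := by
    rw [Prod.dist_eq, dist_self, max_eq_left dist_nonneg, NNReal.dist_eq, abs_lt]
    have h2 : (p : ℝ) ≤ q + (δ / 2).toNNReal := by exact_mod_cast hpq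
    rw [Real.coe_toNNReal _ (by positivity)] at h2
    have h3 : (q : ℝ) ≤ p := by exact_mod_cast hqp
    constructor <;> linarith
  have h2 := h (p, q) ⟨⟨zero_le, hpn⟩, zero_le, hqp.trans hpn⟩ (q, q)
    ⟨⟨zero_le, hqp.trans hpn⟩, zero_le, hqp.trans hpn⟩ h1
  rw [h0, dist_zero_right] at h2
  exact h2.le

/-! ### Existence and inner products of stop-time integrals. -/

namespace QuantumStopTime

open TimePartition

variable {k : Type*} [NormedAddCommGroup k] [InnerProductSpace ℂ k] [CompleteSpace k]
  {S : QuantumStopTime k}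

lemma norm_toFun_Ioc_le_of_mem_range (hzero : S.toFun {0} = 0) {f : LTwo k (Ici 0)} {q : ℝ≥0}
    {w : FockR k} (hw : w ∈ LinearMap.range (expShiftL f q).toLinearMap) (a : ℝ≥0∞) :
    ‖S.toFun (Ioc a q) w‖ ≤ ‖w‖ * ‖S.toFun (Ioc a q) (expVec f)‖ :=
  (adaptedAt_Ioc hzero a le_rfl).norm_le_of_mem_range hw

/-- The stop-time integral over `[0, ∞]` of `ε(f|_{[0,s)}) ⊗ Γ_s (y s)` exists for bounded
continuous `y`. -/
lemma exists_hasStopIntegral (hzero : S.toFun {0} = 0) (hfinite : S.toFun {∞} = 0)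
    (f : LTwo k (Ici 0)) {v : ℝ≥0∞ → FockR k} {y : ℝ≥0 → FockR k} (hy : Continuous y) {C : ℝ}
    (hC : ∀ s, ‖y s‖ ≤ C) (hv : ∀ s : ℝ≥0, v s = expShiftL f s (y s)) :
    ∃ w, S.HasStopIntegral ∞ v w := by
  have hvc : Continuous fun s : ℝ≥0 => v s := by
    simp only [hv]
    exact continuous_expShiftL_comp f hy
  have hC0 : 0 ≤ C := (norm_nonneg _).trans (hC 0)
  obtain ⟨M, hM0, hvM⟩ : ∃ M : ℝ, 0 ≤ M ∧ ∀ s : ℝ≥0, ‖v s‖ ≤ M := by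
    refine ⟨‖expVec f‖ * C, mul_nonneg (norm_nonneg _) hC0, fun s => ?_⟩
    rw [hv]
    exact ((expShiftL f s).le_of_opNorm_le (norm_expShiftL_le f s) _).trans
      (mul_le_mul_of_nonneg_left (hC s) (norm_nonneg _))
  have hmem : ∀ p q : ℝ≥0, q ≤ p → v p ∈ LinearMap.range (expShiftL f q).toLinearMap :=
    fun p q h => by rw [hv]; exact range_expShiftL_antitone h f _
  have key : ∀ ε > 0, ∃ π : TimePartition ∞, ∀ π' : TimePartition ∞, π ≤ π' →
      ‖∑ p ∈ π.1.erase 0, S.increment π p (v p) -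
        ∑ q ∈ π'.1.erase 0, S.increment π' q (v q)‖ ≤ ε := by
    intro ε hε
    suffices h : ∃ π : TimePartition ∞, ∀ π' : TimePartition ∞, π ≤ π' →
        ‖∑ q ∈ π'.1.erase 0, S.increment π' q (v (ceil π q) - v q)‖ ≤ ε by
      obtain ⟨π, hπ⟩ := h
      refine ⟨π, fun π' h => ?_⟩
      rw [sum_increment_refine h, ← Finset.sum_sub_distrib]
      simpa only [map_sub] using hπ π' h
    -- The value at `∞` is arbitrary, so `v ∞` serves as second dominating vector. The constant
    -- covers `(2M)²` for finite `p`, and for `p = ∞` the factors in `(a + M b)² ≤ 2a² + 2M²b²`.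
    refine exists_partition_norm_sum_le hfinite (d := fun p q => v p - v q)
      (e := expVec f) (z := v ∞) (C := 4 * M ^ 2 + 2) (by positivity) (fun η hη n => ?_)
      (fun p q hqp a => ?_) hε
    · obtain ⟨δ, hδ, h⟩ := exists_uniform_near_diagonal (D := fun p : ℝ≥0 × ℝ≥0 => v p.1 - v p.2)
        ((hvc.comp continuous_fst).sub (hvc.comp continuous_snd)) (fun q => sub_self _) hη n
      refine ⟨δ, hδ, fun p q h1 h2 h3 a => ?_⟩
      refine (norm_toFun_Ioc_le_of_mem_range hzero
        (Submodule.sub_mem _ (hmem p q h1) (hmem q q le_rfl)) a).trans ?_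
      gcongr
      exact h p q h1 h2 h3
    · have hz : 0 ≤ ‖S.toFun (Ioc a q) (v ∞)‖ := norm_nonneg _
      have he : 0 ≤ ‖S.toFun (Ioc a q) (expVec f)‖ := norm_nonneg _
      induction p with
      | top =>
        induction q with
        | top =>
          rw [sub_self, _root_.map_zero, norm_zero, zero_pow two_ne_zero]
          positivity
        | coe q =>
          have h1 := norm_toFun_Ioc_le_of_mem_range hzero (hmem q q le_rfl) a
          have h2 : ‖S.toFun (Ioc a q) (v ∞ - v q)‖ ≤
              ‖S.toFun (Ioc a q) (v ∞)‖ + M * ‖S.toFun (Ioc a q) (expVec f)‖ := by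
            rw [map_sub]
            refine (norm_sub_le _ _).trans (add_le_add le_rfl (h1.trans ?_))
            gcongr
            exact hvM q
          refine (pow_le_pow_left₀ (norm_nonneg _) h2 2).trans ?_
          nlinarith [sq_nonneg (‖S.toFun (Ioc a q) (v ∞)‖ - M * ‖S.toFun (Ioc a q) (expVec f)‖),
            sq_nonneg (M * ‖S.toFun (Ioc a q) (expVec f)‖),
            sq_nonneg (M * ‖S.toFun (Ioc a q) (v ∞)‖),
            sq_nonneg (‖S.toFun (Ioc a q) (expVec f)‖)]
      | coe p =>
        lift q to ℝ≥0 using ne_top_of_le_ne_top ENNReal.coe_ne_top hqp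
        have hqp' : q ≤ p := by exact_mod_cast hqp
        have h1 := norm_toFun_Ioc_le_of_mem_range hzero
          (Submodule.sub_mem _ (hmem p q hqp') (hmem q q le_rfl)) a
        have h2 : ‖v p - v q‖ ≤ 2 * M := by
          refine (norm_sub_le _ _).trans ?_
          linarith [hvM p, hvM q]
        have h3 : ‖S.toFun (Ioc a q) (v p - v q)‖ ≤ 2 * M * ‖S.toFun (Ioc a q) (expVec f)‖ :=
          h1.trans (by gcongr)
        refine (pow_le_pow_left₀ (norm_nonneg _) h3 2).trans ?_
        nlinarith [sq_nonneg (M * ‖S.toFun (Ioc a q) (v ∞)‖),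
          sq_nonneg (‖S.toFun (Ioc a q) (v ∞)‖), sq_nonneg (‖S.toFun (Ioc a q) (expVec f)‖)]
  refine cauchy_map_iff_exists_tendsto.1 (Metric.cauchy_iff.2 ⟨inferInstance, fun ε hε => ?_⟩)
  obtain ⟨π, hπ⟩ := key (ε / 3) (by positivity)
  refine ⟨_, image_mem_map (mem_atTop π), ?_⟩
  rintro _ ⟨π₁, h₁, rfl⟩ _ ⟨π₂, h₂, rfl⟩
  rw [dist_eq_norm]
  have a1 := hπ π₁ h₁
  have a2 := hπ π₂ h₂
  rw [norm_sub_rev] at a1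
  refine lt_of_le_of_lt (norm_sub_le_norm_sub_add_norm_sub _
    (∑ p ∈ π.1.erase 0, S.increment π p (v p)) _) ?_
  linarith

lemma exists_hasStopIntegral_expShift (hzero : S.toFun {0} = 0) (hfinite : S.toFun {∞} = 0)
    (f : LTwo k (Ici 0)) (x : FockR k) : ∃ w, S.HasStopIntegral ∞ (expShift f x) w :=
  exists_hasStopIntegral hzero hfinite f (y := fun _ => x) continuous_const (fun _ => le_rfl)
    (fun s => expShift_coe f x s)

/-- Orthogonality leaves only diagonal terms in the inner product of two partition sums. In the term
at `p < ∞` the operator is `S` of an interval ending no later than `p`, hence adapted at `p`, so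
`AdaptedAt.inner_expShiftL` applies term by term. -/
lemma inner_hasStopIntegral (hzero : S.toFun {0} = 0) (hfinite : S.toFun {∞} = 0)
    {f g : LTwo k (Ici 0)} {x y x' y' a b a' b' : FockR k}
    (ha : S.HasStopIntegral ∞ (expShift f x) a) (hb : S.HasStopIntegral ∞ (expShift g y) b)
    (ha' : S.HasStopIntegral ∞ (expShift f x') a') (hb' : S.HasStopIntegral ∞ (expShift g y') b')
    (m : ℝ≥0∞) :
    inner ℂ a (S.toFun (Icc 0 m) b) * inner ℂ x' y' =
      inner ℂ a' (S.toFun (Icc 0 m) b') * inner ℂ x y := by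
  -- At `∞` the integrand `ε(f)` does not depend on `x` and would spoil the termwise identity; it is
  -- replaced by `0`, which leaves the integral unchanged.
  set v : LTwo k (Ici 0) → FockR k → ℝ≥0∞ → FockR k :=
    fun f x s => if s = ∞ then 0 else expShift f x s with hv
  have hcongr : ∀ {f x a}, S.HasStopIntegral ∞ (expShift f x) a → S.HasStopIntegral ∞ (v f x) a :=
    fun h => h.congr hfinite fun s => by rw [hv]; simp
  have hlim : ∀ {f g x y a b}, S.HasStopIntegral ∞ (expShift f x) a →
      S.HasStopIntegral ∞ (expShift g y) b →
      Tendsto (fun π : TimePartition ∞ => ∑ p ∈ π.1.erase 0,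
        inner ℂ (v f x p) (S.increment π p (S.toFun (Icc 0 m) (v g y p)))) atTop
        (𝓝 (inner ℂ a (S.toFun (Icc 0 m) b))) := by
    intro f g x y a b ha hb
    have h1 := (hcongr ha).inner (𝕜 := ℂ)
      (((S.toFun (Icc 0 m)).continuous.tendsto b).comp (hcongr hb))
    refine h1.congr fun π => ?_
    refine Eq.trans ?_ (S.inner_sum_toFun (fun _ _ => measurableSet_Ioc)
      (pairwiseDisjoint_Ioc_pred π) _ _)
    rw [Function.comp, map_sum]
    congr 1
    refine Finset.sum_congr rfl fun p _ => ?_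
    rw [increment, S.toFun_apply_toFun measurableSet_Icc measurableSet_Ioc,
      S.toFun_apply_toFun measurableSet_Ioc measurableSet_Icc, inter_comm]
  refine tendsto_nhds_unique ((hlim ha hb).mul_const _)
    (((hlim ha' hb').mul_const _).congr fun π => ?_)
  rw [Finset.sum_mul, Finset.sum_mul]
  refine Finset.sum_congr rfl fun p _ => ?_
  induction p with
  | top => simp [hv]
  | coe p =>
    have hset : Ioc (π.pred p) (p : ℝ≥0∞) ∩ Icc 0 m = Ioc (π.pred p) (min (p : ℝ≥0∞) m) := by
      ext s
      simp only [mem_inter_iff, mem_Ioc, mem_Icc, zero_le, true_and, le_min_iff, and_assoc]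
    obtain ⟨r, hr⟩ : ∃ r : ℝ≥0, (r : ℝ≥0∞) = min (p : ℝ≥0∞) m :=
      ⟨_, ENNReal.coe_toNNReal (ne_top_of_le_ne_top ENNReal.coe_ne_top (min_le_left _ _))⟩
    have hrp : r ≤ p := by rw [← ENNReal.coe_le_coe, hr]; exact min_le_left _ _
    rw [increment, S.toFun_apply_toFun measurableSet_Ioc measurableSet_Icc,
      S.toFun_apply_toFun measurableSet_Ioc measurableSet_Icc, hset, ← hr]
    simp only [hv, ENNReal.coe_ne_top, if_false, expShift_coe]
    exact (adaptedAt_Ioc hzero _ hrp).inner_expShiftL f g x' y' x y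

lemma sum_increment_const (hzero : S.toFun {0} = 0) (π : TimePartition ∞) (x : FockR k) :
    ∑ p ∈ π.1.erase 0, S.increment π p x = x := by
  rw [← sum_apply]
  have h1 := S.toFun_biUnion (fun _ _ => measurableSet_Ioc) (pairwiseDisjoint_Ioc_pred π)
  have h2 : S.toFun {0} + S.toFun (Ioc 0 ∞) = 1 := by
    rw [← S.toFun_union (measurableSet_singleton _) measurableSet_Ioc (by simp), ← S.map_univ]
    congr 1
    ext s
    simp
  rw [biUnion_Ioc_pred] at h1
  rw [hzero, zero_add, h1] at h2
  unfold increment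
  rw [h2, one_apply_eq_self]

lemma increment_sum {t : ℝ≥0∞} (π : TimePartition t) {p : ℝ≥0∞} (hp : p ∈ π.1.erase 0)
    (w : ℝ≥0∞ → FockR k) :
    S.increment π p (∑ q ∈ π.1.erase 0, S.increment π q (w q)) = S.increment π p (w p) := by
  have h : ∀ q ∈ π.1.erase 0, q ≠ p → S.increment π p (S.increment π q (w q)) = 0 :=
    fun q hq hqp => S.toFun_apply_eq_zero measurableSet_Ioc measurableSet_Ioc
      (pairwiseDisjoint_Ioc_pred π hp hq hqp.symm) _
  rw [map_sum, Finset.sum_eq_single_of_mem p hp h]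
  exact (S.isStarProjection _ measurableSet_Ioc).apply_apply _

lemma increment_timeProj (hzero : S.toFun {0} = 0) {t : ℝ≥0∞} (π : TimePartition t) (p : ℝ≥0∞)
    (x : FockR k) : S.increment π p (timeProj p x) = timeProj p (S.increment π p x) := by
  induction p with
  | top => rw [timeProj_top]; rfl
  | coe p =>
    rw [timeProj_coe]
    exact congrArg (fun T : FockR k →L[ℂ] FockR k => T x)
      ((adaptedAt_Ioc hzero _ le_rfl).comp_tensorAt _)

lemma increment_ccrFlow (hzero : S.toFun {0} = 0) (X : FockR k →L[ℂ] FockR k) {t : ℝ≥0∞}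
    (π : TimePartition t) (p : ℝ≥0∞) (x : FockR k) :
    S.increment π p (ccrFlow p X x) = ccrFlow p X (S.increment π p x) := by
  induction p with
  | top => rw [ccrFlow, if_pos rfl]; rfl
  | coe p =>
    rw [ccrFlow_coe]
    exact congrArg (fun T : FockR k →L[ℂ] FockR k => T x)
      ((adaptedAt_Ioc hzero _ le_rfl).comp_tensorAt _)

/-- Commutation brings each increment next to `x`, where the Bessel inequality applies. The bound is
uniform in `π`, so convergence need be tested only on exponential vectors. -/
lemma norm_sum_increment_le {t : ℝ≥0∞} (π : TimePartition t) {A : ℝ≥0∞ → FockR k →L[ℂ] FockR k}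
    {M : ℝ} (hM : 0 ≤ M) (hA : ∀ p, ‖A p‖ ≤ M)
    (hc : ∀ p x, S.increment π p (A p x) = A p (S.increment π p x)) (x : FockR k) :
    ‖∑ p ∈ π.1.erase 0, S.increment π p (A p x)‖ ≤ M * ‖x‖ := by
  refine le_of_sq_le_sq ?_ (by positivity)
  rw [norm_sq_sum_increment, mul_pow]
  refine le_trans ?_ (mul_le_mul_of_nonneg_left (S.sum_norm_sq_increment_le π x) (sq_nonneg M))
  rw [Finset.mul_sum]
  refine Finset.sum_le_sum fun p _ => ?_
  rw [hc, ← mul_pow]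
  gcongr
  exact (A p).le_of_opNorm_le (hA p) _

end QuantumStopTime

end StoppedCCR

namespace StoppedCCR

/-! ### Strong limits of operators. -/

section StrongLimits

variable {E : Type*} [NormedAddCommGroup E] [InnerProductSpace ℂ E] {ι : Type*}

lemma exists_strongTendsto {l : Filter ι} [l.NeBot] {A : ι → E →L[ℂ] E} {C : ℝ}
    (h : ∀ x, ∃ y, Tendsto (fun i => A i x) l (𝓝 y) ∧ ‖y‖ ≤ C * ‖x‖) :
    ∃ T, StrongTendsto A l T := by
  choose T hT hC using h
  refine ⟨LinearMap.mkContinuous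
    { toFun := T
      map_add' := fun x y => tendsto_nhds_unique (hT (x + y))
        (by simpa only [map_add] using (hT x).add (hT y))
      map_smul' := fun c x => tendsto_nhds_unique (hT (c • x))
        (by simpa only [map_smul, RingHom.id_apply] using (hT x).const_smul c) } C hC, hT⟩

lemma exists_strongTendsto_of_total [CompleteSpace E] {κ : Type*} {φ : κ → E} (hφ : Total φ)
    {l : Filter ι} [l.NeBot] {A : ι → E →L[ℂ] E} {C : ℝ} (hA : ∀ i, ‖A i‖ ≤ C)
    (h : ∀ j, ∃ y, Tendsto (fun i => A i (φ j)) l (𝓝 y)) : ∃ T, StrongTendsto A l T := by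
  refine exists_strongTendsto (C := C) fun x => ?_
  obtain ⟨y, hy⟩ := exists_tendsto_of_total hφ hA h x
  exact ⟨y, hy, le_of_tendsto hy.norm (Eventually.of_forall fun i => (A i).le_of_opNorm_le (hA i) x)⟩

lemma strongLim_spec [Preorder ι] {A : ι → E →L[ℂ] E}
    (h : ∃ T, StrongTendsto A atTop T) : StrongTendsto A atTop (strongLim A) := by
  rw [strongLim, dif_pos h]
  exact h.choose_spec

lemma StrongTendsto.apply_tendsto {l : Filter ι} {A : ι → E →L[ℂ] E} {T : E →L[ℂ] E}
    (h : StrongTendsto A l T) {C : ℝ} (hA : ∀ i, ‖A i‖ ≤ C) {x : ι → E} {y : E}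
    (hx : Tendsto x l (𝓝 y)) : Tendsto (fun i => A i (x i)) l (𝓝 (T y)) := by
  have h1 : Tendsto (fun i => A i (x i - y)) l (𝓝 0) := by
    have h2 : Tendsto (fun i => C * ‖x i - y‖) l (𝓝 0) := by
      simpa using (tendsto_iff_norm_sub_tendsto_zero.1 hx).const_mul C
    exact squeeze_zero_norm (fun i => (A i).le_of_opNorm_le (hA i) _) h2
  have h3 := h1.add (h y)
  rw [zero_add] at h3
  exact h3.congr fun i => by rw [← map_add, sub_add_cancel]

lemma StrongTendsto.isStarProjection [CompleteSpace E] {l : Filter ι} [l.NeBot]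
    {A : ι → E →L[ℂ] E} {T : E →L[ℂ] E} (h : StrongTendsto A l T)
    (hA : ∀ i, IsStarProjection (A i)) : IsStarProjection T := by
  constructor
  · ext x
    have hb : ∀ i, ‖A i‖ ≤ 1 := fun i =>
      ContinuousLinearMap.opNorm_le_bound _ zero_le_one fun x => by
        rw [one_mul]; exact (hA i).norm_apply_le x
    exact tendsto_nhds_unique (h.apply_tendsto hb (h x))
      ((h x).congr fun i => ((hA i).apply_apply x).symm)
  · change ContinuousLinearMap.adjoint T = T
    ext x
    refine ext_inner_left ℂ fun y => ?_
    rw [ContinuousLinearMap.adjoint_inner_right]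
    exact tendsto_nhds_unique ((h y).inner tendsto_const_nhds)
      ((tendsto_const_nhds.inner (h x)).congr fun i => ((hA i).inner_left y x).symm)

lemma Total.rangeRestrict {F κ : Type*} [NormedAddCommGroup F] [InnerProductSpace ℂ F] {φ : κ → E}
    (hφ : Total φ) (T : E →L[ℂ] F) :
    Total fun i => (⟨T (φ i), φ i, rfl⟩ : LinearMap.range T.toLinearMap) := by
  set R : E →L[ℂ] LinearMap.range T.toLinearMap :=
    T.codRestrict (LinearMap.range T.toLinearMap) fun x => ⟨x, rfl⟩ with hR
  have hd : DenseRange R := by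
    refine Function.Surjective.denseRange ?_
    rintro ⟨_, x, rfl⟩
    exact ⟨x, rfl⟩
  have h := hd.dense_image R.continuous hφ
  refine h.mono ?_
  have h1 : R '' (Submodule.span ℂ (range φ) : Set E) =
      Submodule.span ℂ (R '' range φ) := by
    rw [← ContinuousLinearMap.coe_coe, ← Submodule.map_span]; rfl
  rw [h1, ← range_comp]
  exact le_rfl

end StrongLimits

/-! ### The operators `E_{S,t}`, `Γ_S` and `σ_S(X)`. -/

namespace QuantumStopTime

open TimePartition

variable {k : Type*} [NormedAddCommGroup k] [InnerProductSpace ℂ k] [CompleteSpace k]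
  {S : QuantumStopTime k}

lemma projSum_apply {t : ℝ≥0∞} (π : TimePartition t) (x : FockR k) :
    S.projSum π x = ∑ p ∈ π.1.erase 0, S.increment π p (timeProj p x) := by
  rw [projSum, sum_apply]; rfl

lemma shiftSum_apply (π : TimePartition ∞) (x : FockR k) :
    S.shiftSum π x = ∑ p ∈ π.1.erase 0, S.increment π p (shiftOp p x) := by
  rw [shiftSum, sum_apply]; rfl

lemma flowSum_apply (hzero : S.toFun {0} = 0) (X : FockR k →L[ℂ] FockR k) (π : TimePartition ∞)
    (x : FockR k) :
    S.flowSum X π x = ∑ p ∈ π.1.erase 0, S.increment π p (ccrFlow p X x) := by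
  rw [flowSum, sum_apply]
  exact Finset.sum_congr rfl fun p _ => (increment_ccrFlow hzero X π p x).symm

lemma norm_projSum_le (hzero : S.toFun {0} = 0) {t : ℝ≥0∞} (π : TimePartition t) :
    ‖S.projSum π‖ ≤ 1 :=
  ContinuousLinearMap.opNorm_le_bound _ zero_le_one fun x => by
    rw [projSum_apply]
    refine norm_sum_increment_le π zero_le_one (fun p => ?_) (fun p x =>
      increment_timeProj hzero π p x) x
    exact ContinuousLinearMap.opNorm_le_bound _ zero_le_one fun x => by
      rw [one_mul]; exact (isStarProjection_timeProj p).norm_apply_le x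

lemma norm_flowSum_le (hzero : S.toFun {0} = 0) (X : FockR k →L[ℂ] FockR k) (π : TimePartition ∞) :
    ‖S.flowSum X π‖ ≤ max 1 ‖X‖ :=
  ContinuousLinearMap.opNorm_le_bound _ (by positivity) fun x => by
    rw [flowSum_apply hzero]
    exact norm_sum_increment_le π (by positivity) (fun p => norm_ccrFlow_le p X) (fun p x =>
      increment_ccrFlow hzero X π p x) x

/-- By adaptedness each increment commutes with its time projection, so the summands are mutually
orthogonal projections. -/
lemma isStarProjection_projSum (hzero : S.toFun {0} = 0) {t : ℝ≥0∞} (π : TimePartition t) :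
    IsStarProjection (S.projSum π) := by
  constructor
  · ext1 x
    rw [mul_apply_eq_comp, projSum_apply, projSum_apply]
    refine Finset.sum_congr rfl fun p hp => ?_
    rw [increment_timeProj hzero, increment_sum π hp, increment_timeProj hzero,
      (isStarProjection_timeProj p).apply_apply]
  · change ContinuousLinearMap.adjoint _ = _
    ext1 x
    refine ext_inner_left ℂ fun y => ?_
    rw [ContinuousLinearMap.adjoint_inner_right, projSum_apply, projSum_apply, sum_inner, inner_sum]
    refine Finset.sum_congr rfl fun p _ => ?_
    rw [increment, (S.isStarProjection _ measurableSet_Ioc).inner_left,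
      (isStarProjection_timeProj p).inner_left]
    congr 1
    exact (increment_timeProj hzero π p x).symm

lemma timeProj_expVec_eq_expShift (f : LTwo k (Ici 0)) (s : ℝ≥0∞) :
    timeProj s (expVec f) = expShift f (expVec 0) s := by
  induction s with
  | top => rw [timeProj_top, expShift_top]; rfl
  | coe s => rw [timeProj_expVec, expShift_coe]

lemma strongTendsto_projSum_top (hzero : S.toFun {0} = 0) (hfinite : S.toFun {∞} = 0) :
    StrongTendsto (fun π : TimePartition ∞ => S.projSum π) atTop (S.proj ∞) := by
  refine strongLim_spec (exists_strongTendsto_of_total total_expVec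
    (fun π => norm_projSum_le hzero π) fun f => ?_)
  obtain ⟨y, hy⟩ := exists_hasStopIntegral_expShift hzero hfinite f (expVec 0)
  refine ⟨y, Tendsto.congr (fun π => ?_) hy⟩
  simp only [projSum_apply, timeProj_expVec_eq_expShift]

lemma strongTendsto_projSum_toFun_comp (hzero : S.toFun {0} = 0) (hfinite : S.toFun {∞} = 0)
    (t : ℝ≥0∞) : StrongTendsto (fun π : TimePartition t => S.projSum π) atTop
      (S.toFun (Icc 0 t) ∘L S.proj ∞) := by
  intro x
  have h : S.HasStopIntegral ∞ (fun p => timeProj p x) (S.proj ∞ x) :=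
    (strongTendsto_projSum_top hzero hfinite x).congr fun π => projSum_apply π x
  exact Tendsto.congr (fun π => (projSum_apply π x).symm) (h.restrict t)

lemma strongTendsto_projSum (hzero : S.toFun {0} = 0) (hfinite : S.toFun {∞} = 0) (t : ℝ≥0∞) :
    StrongTendsto (fun π : TimePartition t => S.projSum π) atTop (S.proj t) :=
  strongLim_spec ⟨_, strongTendsto_projSum_toFun_comp hzero hfinite t⟩

lemma proj_apply (hzero : S.toFun {0} = 0) (hfinite : S.toFun {∞} = 0) (t : ℝ≥0∞) (x : FockR k) :
    S.proj t x = S.toFun (Icc 0 t) (S.proj ∞ x) :=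
  tendsto_nhds_unique (strongTendsto_projSum hzero hfinite t x)
    (strongTendsto_projSum_toFun_comp hzero hfinite t x)

lemma isStarProjection_proj (hzero : S.toFun {0} = 0) (hfinite : S.toFun {∞} = 0) (t : ℝ≥0∞) :
    IsStarProjection (S.proj t) :=
  (strongTendsto_projSum hzero hfinite t).isStarProjection fun π => isStarProjection_projSum hzero π

/-- `E_{S,t} = S([0,t]) E_S` is self-adjoint, so the two factors commute and `E_{S,t} = E_S
S([0,t])`. -/
lemma proj_mem_preSpace (hzero : S.toFun {0} = 0) (hfinite : S.toFun {∞} = 0) (t : ℝ≥0∞)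
    (x : FockR k) : S.proj t x ∈ S.preSpace := by
  have hE := isStarProjection_proj hzero hfinite ∞
  have ht := isStarProjection_proj hzero hfinite t
  have hSt := S.isStarProjection (Icc 0 t) measurableSet_Icc
  have hcomm : ∀ z, S.proj t z = S.proj ∞ (S.toFun (Icc 0 t) z) := fun z =>
    ext_inner_left ℂ fun y => by
      rw [← ht.inner_left, proj_apply hzero hfinite, hSt.inner_left, hE.inner_left]
  exact ⟨S.toFun (Icc 0 t) x, (hcomm x).symm⟩

lemma hasStopIntegral_proj (hzero : S.toFun {0} = 0) (hfinite : S.toFun {∞} = 0)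
    (f : LTwo k (Ici 0)) :
    S.HasStopIntegral ∞ (expShift f (expVec 0)) (S.proj ∞ (expVec f)) := by
  refine (strongTendsto_projSum hzero hfinite ∞ (expVec f)).congr fun π => ?_
  simp only [projSum_apply, timeProj_expVec_eq_expShift]

lemma inner_expVec_zero : inner ℂ (expVec (0 : LTwo k (Ici 0))) (expVec 0) = 1 := by
  rw [inner_expVec, inner_zero_left, Complex.exp_zero]

/-- The strong Markov property, in the form of the Gram matrix of the stop-time integrals. -/
lemma inner_hasStopIntegral_expShift (hzero : S.toFun {0} = 0) (hfinite : S.toFun {∞} = 0)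
    {f g : LTwo k (Ici 0)} {x y a b : FockR k}
    (ha : S.HasStopIntegral ∞ (expShift f x) a) (hb : S.HasStopIntegral ∞ (expShift g y) b)
    (m : ℝ≥0∞) :
    inner ℂ a (S.toFun (Icc 0 m) b) =
      inner ℂ (S.proj ∞ (expVec f)) (S.toFun (Icc 0 m) (S.proj ∞ (expVec g))) * inner ℂ x y := by
  -- The comparison vectors are `x' = y' = ε(0)`, a unit vector whose integrals are `E_S ε(f)` and
  -- `E_S ε(g)`.
  have h := inner_hasStopIntegral hzero hfinite ha hb (hasStopIntegral_proj hzero hfinite f)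
    (hasStopIntegral_proj hzero hfinite g) m
  rwa [inner_expVec_zero, mul_one] at h

lemma toFun_Icc_top : S.toFun (Icc 0 ∞) = 1 := by
  rw [← S.map_univ]
  congr 1
  ext s
  simp

lemma proj_expVec_zero (hzero : S.toFun {0} = 0) (hfinite : S.toFun {∞} = 0) :
    S.proj ∞ (expVec 0) = expVec 0 := by
  refine tendsto_nhds_unique (hasStopIntegral_proj hzero hfinite 0) ?_
  have h : ∀ p : ℝ≥0∞, expShift (k := k) 0 (expVec 0) p = expVec 0 := by
    intro p
    induction p with
    | top => exact expShift_top _ _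
    | coe p => rw [expShift_coe, expShiftL_expVec, cutoff, _root_.map_zero, _root_.map_zero, _root_.map_zero, add_zero]
  simp only [h, sum_increment_const hzero]
  exact tendsto_const_nhds

lemma norm_eq_of_hasStopIntegral_zero (hzero : S.toFun {0} = 0) (hfinite : S.toFun {∞} = 0)
    {x a : FockR k} (ha : S.HasStopIntegral ∞ (expShift 0 x) a) : ‖a‖ = ‖x‖ := by
  have h := inner_hasStopIntegral_expShift hzero hfinite ha ha ∞
  rw [toFun_Icc_top, one_apply_eq_self, one_apply_eq_self, proj_expVec_zero hzero hfinite,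
    inner_expVec_zero, one_mul] at h
  rw [@norm_eq_sqrt_re_inner ℂ, h, ← @norm_eq_sqrt_re_inner ℂ]

lemma strongTendsto_shiftSum (hzero : S.toFun {0} = 0) (hfinite : S.toFun {∞} = 0) :
    StrongTendsto S.shiftSum atTop S.shift := by
  refine strongLim_spec (exists_strongTendsto (C := 1) fun x => ?_)
  obtain ⟨y, hy⟩ := exists_hasStopIntegral_expShift hzero hfinite 0 x
  refine ⟨y, ?_, by rw [norm_eq_of_hasStopIntegral_zero hzero hfinite hy, one_mul]⟩
  -- The integrands agree at finite times; at `∞` one is `E_0 x` and the other `ε(0)`.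
  have h := hy.congr hfinite (w := fun s => shiftOp s x) fun s => by rw [shiftOp_coe, expShift_coe]
  exact Tendsto.congr (fun π => (shiftSum_apply π x).symm) h

lemma hasStopIntegral_shift (hzero : S.toFun {0} = 0) (hfinite : S.toFun {∞} = 0) (x : FockR k) :
    S.HasStopIntegral ∞ (expShift 0 x) (S.shift x) := by
  have h : S.HasStopIntegral ∞ (fun s => shiftOp s x) (S.shift x) :=
    (strongTendsto_shiftSum hzero hfinite x).congr fun π => shiftSum_apply π x
  exact h.congr hfinite fun s => by rw [shiftOp_coe, expShift_coe]

lemma norm_shift (hzero : S.toFun {0} = 0) (hfinite : S.toFun {∞} = 0) (x : FockR k) :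
    ‖S.shift x‖ = ‖x‖ :=
  norm_eq_of_hasStopIntegral_zero hzero hfinite (hasStopIntegral_shift hzero hfinite x)

lemma inner_shift (hzero : S.toFun {0} = 0) (hfinite : S.toFun {∞} = 0) (x y : FockR k) :
    inner ℂ (S.shift x) (S.shift y) = inner ℂ x y := by
  have h := inner_hasStopIntegral_expShift hzero hfinite (hasStopIntegral_shift hzero hfinite x)
    (hasStopIntegral_shift hzero hfinite y) ∞
  rwa [toFun_Icc_top, one_apply_eq_self, one_apply_eq_self, proj_expVec_zero hzero hfinite,
    inner_expVec_zero, one_mul] at h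

lemma ccrFlow_expShift (X : FockR k →L[ℂ] FockR k) (f : LTwo k (Ici 0)) (x : FockR k) (s : ℝ≥0∞) :
    ccrFlow s X (expShift f x s) = expShift f (X x) s := by
  induction s with
  | top => rw [expShift_top, expShift_top, ccrFlow, if_pos rfl]; rfl
  | coe s => rw [expShift_coe, expShift_coe, ccrFlow_expShiftL]

lemma norm_expVec_leftShift_le (f : LTwo k (Ici 0)) (s : ℝ≥0) :
    ‖expVec (leftShift s f)‖ ≤ ‖expVec f‖ := by
  have h := norm_le_norm_expShiftL f s (expVec (leftShift s f))
  rwa [expShiftL_leftShift] at h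

lemma strongTendsto_flowSum (hzero : S.toFun {0} = 0) (hfinite : S.toFun {∞} = 0)
    (X : FockR k →L[ℂ] FockR k) : StrongTendsto (S.flowSum X) atTop (S.flow X) := by
  refine strongLim_spec (exists_strongTendsto_of_total total_expVec (norm_flowSum_le hzero X)
    fun f => ?_)
  obtain ⟨w, hw⟩ := exists_hasStopIntegral hzero hfinite f (v := fun s => ccrFlow s X (expVec f))
    (y := fun s => X (expVec (leftShift s f))) (C := ‖X‖ * ‖expVec f‖)
    (X.continuous.comp (continuous_expVec.comp (continuous_leftShift f)))
    (fun s => (X.le_opNorm _).trans (by gcongr; exact norm_expVec_leftShift_le f s))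
    (fun s => by rw [← ccrFlow_expShiftL, expShiftL_leftShift])
  exact ⟨w, Tendsto.congr (fun π => (flowSum_apply hzero X π _).symm) hw⟩

/-- Applying the approximant of `σ_S(X)` to the approximant of `a` over the same partition leaves
only diagonal terms, in each of which `x` becomes `X x`. The uniform bound lets both limits be taken
at once. -/
lemma hasStopIntegral_flow (hzero : S.toFun {0} = 0) (hfinite : S.toFun {∞} = 0)
    (X : FockR k →L[ℂ] FockR k) {f : LTwo k (Ici 0)} {x a : FockR k}
    (ha : S.HasStopIntegral ∞ (expShift f x) a) :
    S.HasStopIntegral ∞ (expShift f (X x)) (S.flow X a) := by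
  refine ((strongTendsto_flowSum hzero hfinite X).apply_tendsto (norm_flowSum_le hzero X) ha).congr
    fun π => ?_
  rw [flowSum, sum_apply]
  refine Finset.sum_congr rfl fun p hp => ?_
  rw [ContinuousLinearMap.comp_apply, increment_sum π hp, ← increment_ccrFlow hzero,
    ccrFlow_expShift]

end QuantumStopTime

end StoppedCCR

namespace StoppedCCR

/-! ### Isometries determined on total families. -/

section Isometries

variable {E F G : Type*} [NormedAddCommGroup E] [InnerProductSpace ℂ E]
  [NormedAddCommGroup F] [InnerProductSpace ℂ F] [NormedAddCommGroup G] [InnerProductSpace ℂ G]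
  [CompleteSpace G]

lemma exists_isometryEquiv_of_gram_of_range [CompleteSpace E] {ι κ : Type*} {φ : ι → E} {ψ : ι → G}
    {χ : κ → G} (hφ : Total φ) (hχ : Total χ) (h : ∀ i j, inner ℂ (φ i) (φ j) = inner ℂ (ψ i) (ψ j))
    (hr : ∀ K : Submodule ℂ G, IsClosed (K : Set G) → (∀ i, ψ i ∈ K) → ∀ l, χ l ∈ K) :
    ∃ V : E ≃ₗᵢ[ℂ] G, ∀ i, V (φ i) = ψ i := by
  refine exists_isometryEquiv_of_gram hφ ?_ h
  have hle : Submodule.span ℂ (range χ) ≤ (Submodule.span ℂ (range ψ)).topologicalClosure := by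
    rw [Submodule.span_le]
    rintro _ ⟨l, rfl⟩
    exact hr _ (Submodule.isClosed_topologicalClosure _)
      (fun i => Submodule.le_topologicalClosure _ (Submodule.subset_span (mem_range_self i))) l
  exact dense_closure.1 (hχ.mono hle)

lemma isometryEquiv_ext_of_total {ι : Type*} {φ : ι → E} (hφ : Total φ) {j j' : E ≃ₗᵢ[ℂ] G}
    (h : ∀ i, j (φ i) = j' (φ i)) : j = j' := by
  have h1 : (j : E →L[ℂ] G) = j' := ext_of_total hφ h
  exact LinearIsometryEquiv.ext fun z => congrArg (fun T : E →L[ℂ] G => T z) h1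

lemma eq_conj_map_of_total {ι κ : Type*} {φ : ι → E} {ψ ψ' : κ → F} (hφ : Total φ)
    (hψ : Total ψ)
    {j : HTensor E F ≃ₗᵢ[ℂ] G} {T : G →L[ℂ] G} {C : F →L[ℂ] F}
    (hC : ∀ l, C (ψ l) = ψ' l) (h : ∀ i l, T (j (htmul (φ i) (ψ l))) = j (htmul (φ i) (ψ' l))) :
    T = (j : HTensor E F →L[ℂ] G) ∘L HTensor.map (ContinuousLinearMap.id ℂ E) C ∘L
      ContinuousLinearMap.adjoint (j : HTensor E F →L[ℂ] G) := by
  have h1 : T ∘L (j : HTensor E F →L[ℂ] G) =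
      (j : HTensor E F →L[ℂ] G) ∘L HTensor.map (ContinuousLinearMap.id ℂ E) C :=
    ext_of_total (total_htmul hφ hψ) fun i => by
      simp only [ContinuousLinearMap.comp_apply, HTensor.map_htmul, hC]
      exact h i.1 i.2
  have hadj : ∀ y, (j : HTensor E F →L[ℂ] G)
      (ContinuousLinearMap.adjoint (j : HTensor E F →L[ℂ] G) y) = y := fun y => by
    refine ext_inner_left ℂ fun z => ?_
    obtain ⟨w, rfl⟩ := j.surjective z
    change inner ℂ (j w) (j _) = _
    rw [LinearIsometryEquiv.inner_map_map, ContinuousLinearMap.adjoint_inner_right]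
    rfl
  rw [← ContinuousLinearMap.comp_assoc, ← h1]
  ext1 y
  simp only [ContinuousLinearMap.comp_apply, hadj]

end Isometries

/-! ### The strong Markov isomorphism. -/

namespace QuantumStopTime

open TimePartition

variable {k : Type*} [NormedAddCommGroup k] [InnerProductSpace ℂ k] [CompleteSpace k]
  {S : QuantumStopTime k}

lemma pred_le {t : ℝ≥0∞} (π : TimePartition t) (p : ℝ≥0∞) : π.pred p ≤ p :=
  Finset.sup_le fun _ hq => (Finset.mem_filter.1 hq).2.le

/-- Each fine cell lies in exactly one coarse cell, so only `p = ceil π q` survives. The parameter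
of the integrand is thereby frozen on coarse cells. -/
lemma sum_increment_sum {t : ℝ≥0∞} {π π' : TimePartition t} (h : π ≤ π')
    (w : ℝ≥0∞ → ℝ≥0∞ → FockR k) :
    ∑ p ∈ π.1.erase 0, S.increment π p (∑ q ∈ π'.1.erase 0, S.increment π' q (w p q)) =
      ∑ q ∈ π'.1.erase 0, S.increment π' q (w (ceil π q) q) := by
  simp only [map_sum]
  rw [Finset.sum_comm]
  refine Finset.sum_congr rfl fun q hq => ?_
  obtain ⟨hq0, hqm⟩ := Finset.mem_erase.1 hq
  have hqt := π'.2.2.2 q hqm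
  have hc : ceil π q ∈ π.1.erase 0 :=
    Finset.mem_erase.2 ⟨((pos_iff_ne_zero.2 hq0).trans_le (le_ceil π q)).ne', ceil_mem hqt⟩
  have hsub : Ioc (π'.pred q) q ⊆ Ioc (π.pred (ceil π q)) (ceil π q) := by
    rw [Ioc_pred_eq_biUnion h (ceil_mem hqt)]
    exact subset_biUnion_of_mem (u := fun q => Ioc (π'.pred q) q)
      (Finset.mem_filter.2 ⟨hq, rfl⟩)
  have hz : ∀ p ∈ π.1.erase 0, p ≠ ceil π q →
      S.increment π p (S.increment π' q (w p q)) = 0 := fun p hp hpq =>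
    S.toFun_apply_eq_zero measurableSet_Ioc measurableSet_Ioc
      ((pairwiseDisjoint_Ioc_pred π hp hc hpq).mono_right hsub) _
  rw [Finset.sum_eq_single_of_mem _ hc hz, increment, increment,
    S.toFun_apply_toFun measurableSet_Ioc measurableSet_Ioc, inter_eq_right.2 hsub]

/-- The stop-time integrals of the vectors `ε(f|_{[0,s)}) ⊗ Γ_s x` are total. -/
lemma expVec_mem_of_hasStopIntegral_mem (hzero : S.toFun {0} = 0) (hfinite : S.toFun {∞} = 0)
    (K : Submodule ℂ (FockR k)) (hK : IsClosed (K : Set (FockR k)))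
    (hJ : ∀ (f : LTwo k (Ici 0)) (x a : FockR k), S.HasStopIntegral ∞ (expShift f x) a →
      ∀ t, 0 < t → S.toFun (Icc 0 t) a ∈ K) (f : LTwo k (Ici 0)) : expVec f ∈ K := by
  set X : ℝ≥0∞ → FockR k := fun p => if p = ∞ then 0 else expVec (leftShift p.toNNReal f) with hX
  have hXc : ∀ p : ℝ≥0, X p = expVec (leftShift p f) := fun p => by simp [hX]
  have hXt : X ∞ = 0 := by simp [hX]
  choose a ha using fun p => exists_hasStopIntegral_expShift hzero hfinite f (X p)
  refine hK.closure_subset (Metric.mem_closure_iff.2 fun ε hε => ?_)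
  set M := ‖expVec f‖ + ‖expVec f‖ * ‖expVec f‖ with hM
  have hM0 : 0 ≤ M := by positivity
  have hmem : ∀ (q : ℝ≥0) (x : FockR k),
      expVec f - expShiftL f q x ∈ LinearMap.range (expShiftL f q).toLinearMap := fun q x =>
    Submodule.sub_mem _ (expVec_mem_range_expShiftL f q) ⟨x, rfl⟩
  have hpart : ∃ π : TimePartition ∞, ∀ π' : TimePartition ∞, π ≤ π' →
      ‖∑ q ∈ π'.1.erase 0, S.increment π' q (expVec f - expShift f (X (ceil π q)) q)‖ ≤ ε / 2 := by
    -- The error of using `θ_p^* f` in place of `θ_q^* f` vanishes at `p = q`. Its norm is at most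
    -- `M` for finite `p`; for `p = ∞ > q` the error is `ε(f)` because `X ∞ = 0`, which accounts for
    -- the `+ 1`.
    refine exists_partition_norm_sum_le hfinite (d := fun p q => expVec f - expShift f (X p) q)
      (e := expVec f) (z := 0) (C := M ^ 2 + 1) (by positivity) (fun η hη n => ?_)
      (fun p q hqp b => ?_) (by positivity)
    · obtain ⟨δ, hδ, h⟩ := exists_uniform_near_diagonal
        (D := fun p : ℝ≥0 × ℝ≥0 => expVec f - expShiftL f p.2 (expVec (leftShift p.1 f)))
        (continuous_const.sub (continuous_expShiftL_comp f
          (continuous_expVec.comp ((continuous_leftShift f).comp continuous_fst))))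
        (fun q => sub_eq_zero.2 (expShiftL_leftShift f q).symm) hη n
      refine ⟨δ, hδ, fun p q h1 h2 h3 b => ?_⟩
      rw [expShift_coe, hXc]
      refine (norm_toFun_Ioc_le_of_mem_range hzero (hmem q _) b).trans ?_
      gcongr
      exact h p q h1 h2 h3
    · rw [_root_.map_zero, norm_zero, zero_pow two_ne_zero, add_zero]
      induction q with
      | top =>
        rw [expShift_top, sub_self, _root_.map_zero, norm_zero, zero_pow two_ne_zero]
        positivity
      | coe q =>
        induction p with
        | top =>
          rw [hXt, expShift_coe, _root_.map_zero, sub_zero]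
          nlinarith [sq_nonneg (M * ‖S.toFun (Ioc b q) (expVec f)‖)]
        | coe p =>
          rw [expShift_coe, hXc]
          have h1 := norm_toFun_Ioc_le_of_mem_range hzero (hmem q (expVec (leftShift p f))) b
          have h2 : ‖expVec f - expShiftL f q (expVec (leftShift p f))‖ ≤ M := by
            refine (norm_sub_le _ _).trans (add_le_add le_rfl ?_)
            refine ((expShiftL f q).le_of_opNorm_le (norm_expShiftL_le f q) _).trans ?_
            gcongr
            exact norm_expVec_leftShift_le f p
          have h3 := h1.trans (mul_le_mul_of_nonneg_right h2 (norm_nonneg _))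
          refine (pow_le_pow_left₀ (norm_nonneg _) h3 2).trans ?_
          nlinarith [sq_nonneg (‖S.toFun (Ioc b q) (expVec f)‖)]
  obtain ⟨π, hπ⟩ := hpart
  refine ⟨∑ p ∈ π.1.erase 0, S.increment π p (a p), Submodule.sum_mem _ fun p hp => ?_, ?_⟩
  · rw [increment, toFun_Ioc_eq_sub (pred_le π p), sub_apply]
    refine Submodule.sub_mem _ (hJ f _ _ (ha p) p
      (pos_iff_ne_zero.2 (Finset.ne_of_mem_erase hp))) ?_
    -- Membership in `K` is assumed for `t > 0` only; the first cell needs `S({0}) = 0`.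
    rcases eq_or_ne (π.pred p) 0 with h0 | h0
    · rw [h0, Icc_self, hzero, zero_apply]; exact K.zero_mem
    · exact hJ f _ _ (ha p) _ (pos_iff_ne_zero.2 h0)
  -- With `π` fixed, the integrals `a p` are replaced by their sums over `π' ≥ π`. The estimate is
  -- uniform in `π'`, so it passes to the limit.
  · have hlim : Tendsto (fun π' : TimePartition ∞ => ‖expVec f - ∑ p ∈ π.1.erase 0,
        S.increment π p (∑ q ∈ π'.1.erase 0, S.increment π' q (expShift f (X p) q))‖) atTop
        (𝓝 ‖expVec f - ∑ p ∈ π.1.erase 0, S.increment π p (a p)‖) :=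
      (tendsto_const_nhds.sub (tendsto_finsetSum _ fun p _ =>
        ((S.increment π p).continuous.tendsto _).comp (ha p))).norm
    rw [dist_eq_norm]
    refine lt_of_le_of_lt (le_of_tendsto hlim ?_) (half_lt_self hε)
    filter_upwards [eventually_ge_atTop π] with π' hπ'
    have h := hπ π' hπ'
    simp only [map_sub] at h
    rw [Finset.sum_sub_distrib, sum_increment_const hzero] at h
    rwa [sum_increment_sum hπ' fun p q => expShift f (X p) q]

variable (S) in
/-- `E_S ε(f)` as an element of `F_{S)}`. -/
def preVec (f : LTwo k (Ici 0)) : S.preSpace :=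
  ⟨S.proj ∞ (expVec f), LinearMap.mem_range_self (S.proj ∞).toLinearMap (expVec f)⟩

variable (S) in
/-- `Γ_S x` as an element of `F_{[S}`. -/
def postVec (x : FockR k) : S.postSpace :=
  ⟨S.shift x, LinearMap.mem_range_self S.shift.toLinearMap x⟩

variable (S) in
lemma total_preVec : Total S.preVec := total_expVec.rangeRestrict (S.proj ∞)

variable (S) in
lemma total_postVec : Total S.postVec :=
  Total.rangeRestrict (φ := fun x : FockR k => x) (by rw [Total]; simp) S.shift

/-- `E_{S,t} ε(f)` as an element of `F_{S)}`. -/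
def preVecAt (hzero : S.toFun {0} = 0) (hfinite : S.toFun {∞} = 0) (t : ℝ≥0∞)
    (f : LTwo k (Ici 0)) : S.preSpace :=
  ⟨S.proj t (expVec f), proj_mem_preSpace hzero hfinite t (expVec f)⟩

/-- Since `S([0,t]) S([0,u]) = S([0,t ∧ u])`, both sides reduce to the Gram identity at `m = t ∧ u`.
-/
lemma inner_htmul_preVecAt_postVec (hzero : S.toFun {0} = 0) (hfinite : S.toFun {∞} = 0)
    {f g : LTwo k (Ici 0)} {x y a b : FockR k}
    (ha : S.HasStopIntegral ∞ (expShift f x) a) (hb : S.HasStopIntegral ∞ (expShift g y) b)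
    (t u : ℝ≥0∞) :
    inner ℂ (htmul (preVecAt hzero hfinite t f) (S.postVec x))
        (htmul (preVecAt hzero hfinite u g) (S.postVec y)) =
      inner ℂ (S.toFun (Icc 0 t) a) (S.toFun (Icc 0 u) b) := by
  have hset : Icc 0 t ∩ Icc 0 u = Icc 0 (min t u) := by rw [Icc_inter_Icc, max_self]
  have h1 : inner ℂ (preVecAt hzero hfinite t f) (preVecAt hzero hfinite u g) =
      inner ℂ (S.proj t (expVec f)) (S.proj u (expVec g)) := rfl
  have h2 : inner ℂ (S.postVec x) (S.postVec y) = inner ℂ (S.shift x) (S.shift y) := rfl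
  rw [inner_htmul, h1, h2, (S.isStarProjection _ measurableSet_Icc).inner_left,
    S.toFun_apply_toFun measurableSet_Icc measurableSet_Icc, hset,
    inner_hasStopIntegral_expShift hzero hfinite ha hb, inner_shift hzero hfinite,
    proj_apply hzero hfinite t, proj_apply hzero hfinite u,
    (S.isStarProjection _ measurableSet_Icc).inner_left,
    S.toFun_apply_toFun measurableSet_Icc measurableSet_Icc, hset]

lemma exists_strongMarkovIso (hzero : S.toFun {0} = 0) (hfinite : S.toFun {∞} = 0) :
    ∃ j : HTensor S.preSpace S.postSpace ≃ₗᵢ[ℂ] FockR k, S.IsStrongMarkovIso j := by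
  choose J hJ using exists_hasStopIntegral_expShift (S := S) hzero hfinite
  obtain ⟨j, hj⟩ := exists_isometryEquiv_of_gram_of_range
    (φ := fun i : {t : ℝ≥0∞ // 0 < t} × LTwo k (Ici 0) × FockR k =>
      htmul (preVecAt hzero hfinite i.1 i.2.1) (S.postVec i.2.2))
    (ψ := fun i => S.toFun (Icc 0 i.1) (J i.2.1 i.2.2))
    -- The vectors with `t = ∞` are already total.
    ((total_htmul S.total_preVec S.total_postVec).mono (Submodule.span_mono (by
      rintro _ ⟨i, rfl⟩
      exact ⟨(⟨∞, ENNReal.zero_lt_top⟩, i), rfl⟩)))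
    total_expVec
    (fun i i' => inner_htmul_preVecAt_postVec hzero hfinite (hJ _ _) (hJ _ _) _ _)
    (fun K hK h f => expVec_mem_of_hasStopIntegral_mem hzero hfinite K hK
      (fun f x a ha t ht => by
        rw [tendsto_nhds_unique ha (hJ f x)]
        exact h (⟨t, ht⟩, f, x)) f)
  refine ⟨j, fun t ht f x => ⟨proj_mem_preSpace hzero hfinite t (expVec f),
    LinearMap.mem_range_self S.shift.toLinearMap x, ?_⟩⟩
  have h : j (htmul (preVecAt hzero hfinite t f) (S.postVec x)) = S.toFun (Icc 0 t) (J f x) :=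
    hj (⟨t, ht⟩, f, x)
  have h1 := (hJ f x).restrict t
  rw [← h] at h1
  exact h1

lemma IsStrongMarkovIso.hasStopIntegral {j : HTensor S.preSpace S.postSpace ≃ₗᵢ[ℂ] FockR k}
    (hj : S.IsStrongMarkovIso j) (f : LTwo k (Ici 0)) (x : FockR k) :
    S.HasStopIntegral ∞ (expShift f x) (j (htmul (S.preVec f) (S.postVec x))) := by
  obtain ⟨_, _, h⟩ := hj ∞ ENNReal.zero_lt_top f x
  exact h

lemma IsStrongMarkovIso.unique {j j' : HTensor S.preSpace S.postSpace ≃ₗᵢ[ℂ] FockR k}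
    (hj : S.IsStrongMarkovIso j) (hj' : S.IsStrongMarkovIso j') : j = j' :=
  isometryEquiv_ext_of_total (total_htmul S.total_preVec S.total_postVec) fun i =>
    tendsto_nhds_unique (hj.hasStopIntegral i.1 i.2) (hj'.hasStopIntegral i.1 i.2)

lemma adjoint_shift_shift (hzero : S.toFun {0} = 0) (hfinite : S.toFun {∞} = 0) (x : FockR k) :
    ContinuousLinearMap.adjoint S.shift (S.shift x) = x := by
  refine ext_inner_left ℂ fun y => ?_
  rw [ContinuousLinearMap.adjoint_inner_right, inner_shift hzero hfinite]

lemma shiftConj_postVec (hzero : S.toFun {0} = 0) (hfinite : S.toFun {∞} = 0)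
    (X : FockR k →L[ℂ] FockR k) (x : FockR k) :
    S.shiftConj X (S.postVec x) = S.postVec (X x) :=
  Subtype.ext (congrArg (fun y => S.shift (X y)) (adjoint_shift_shift hzero hfinite x))

lemma IsStrongMarkovIso.flow_apply (hzero : S.toFun {0} = 0) (hfinite : S.toFun {∞} = 0)
    {j : HTensor S.preSpace S.postSpace ≃ₗᵢ[ℂ] FockR k} (hj : S.IsStrongMarkovIso j)
    (X : FockR k →L[ℂ] FockR k) (f : LTwo k (Ici 0)) (x : FockR k) :
    S.flow X (j (htmul (S.preVec f) (S.postVec x))) = j (htmul (S.preVec f) (S.postVec (X x))) :=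
  tendsto_nhds_unique (hasStopIntegral_flow hzero hfinite X (hj.hasStopIntegral f x))
    (hj.hasStopIntegral f (X x))

end QuantumStopTime

end StoppedCCR

theorem mainTheorem7 {k : Type*} [NormedAddCommGroup k] [InnerProductSpace ℂ k] [CompleteSpace k]
    (S : QuantumStopTime k) (hzero : S.toFun {0} = 0) (hfinite : S.toFun {∞} = 0) :
    (∀ t : ℝ≥0∞, 0 < t →
      StrongTendsto (fun π : TimePartition t => S.projSum π) atTop (S.proj t) ∧
      IsStarProjection (S.proj t)) ∧
    (StrongTendsto S.shiftSum atTop S.shift ∧ Isometry S.shift) ∧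
    (∀ X : FockR k →L[ℂ] FockR k, StrongTendsto (S.flowSum X) atTop (S.flow X)) ∧
    (∃! j : HTensor S.preSpace S.postSpace ≃ₗᵢ[ℂ] FockR k, S.IsStrongMarkovIso j) ∧
    ∀ j : HTensor S.preSpace S.postSpace ≃ₗᵢ[ℂ] FockR k, S.IsStrongMarkovIso j →
      ∀ X : FockR k →L[ℂ] FockR k,
        S.flow X =
          (j : HTensor S.preSpace S.postSpace →L[ℂ] FockR k) ∘L
            HTensor.map (ContinuousLinearMap.id ℂ S.preSpace) (S.shiftConj X) ∘L
            ContinuousLinearMap.adjoint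
              (j : HTensor S.preSpace S.postSpace →L[ℂ] FockR k) := by
  refine ⟨fun t _ => ⟨QuantumStopTime.strongTendsto_projSum hzero hfinite t,
      QuantumStopTime.isStarProjection_proj hzero hfinite t⟩,
    ⟨QuantumStopTime.strongTendsto_shiftSum hzero hfinite,
      AddMonoidHomClass.isometry_of_norm _ (QuantumStopTime.norm_shift hzero hfinite)⟩,
    fun X => QuantumStopTime.strongTendsto_flowSum hzero hfinite X, ?_,
    fun j hj X => eq_conj_map_of_total S.total_preVec S.total_postVec
      (QuantumStopTime.shiftConj_postVec hzero hfinite X) (hj.flow_apply hzero hfinite X)⟩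
  obtain ⟨j, hj⟩ := QuantumStopTime.exists_strongMarkovIso hzero hfinite
  exact ⟨j, hj, fun j' hj' => hj'.unique hj⟩
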